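/- Conventions. Hilbert C*-modules are right modules with inner product linear in the first variable; $\mathcal L(E,F)$ denotes the adjointable operators, $\mathcal L(E)=\mathcal L(E,E)$, $L(B,E)$ the space of all linear maps $B\to E$, and $M(B)$ the multiplier algebra of $B$. A linear map $\rho:A\to M(B)$ is completely positive iff $\sum_{i,j} b_j^*\rho(a_j^*a_i)b_i\ge 0$ for all finite families $a_i\in A$, $b_i\in B$, and strict iff it is strictly continuous on bounded sets. Let $A,B$ be C*-algebras and let $\varphi$ be a densely defined C*-valued weight from $A$ into $M(B)$. That is, $\mathcal M_\varphi^+\subseteq A^+$ is a hereditary cone, $\mathcal N_\varphi=\{a\in A: a^*a\in\mathcal M_\varphi^+\}$, the space $\mathcal M_\varphi=\operatorname{span}\mathcal M_\varphi^+$ is dense in $A$, and $\varphi:\mathcal M_\varphi\to M(B)$ is a linear map with $\sum_{i,j} b_j^*\varphi(a_j^*a_i)b_i\ge 0$ for all finite families $a_i\in\mathcal N_\varphi$, $b_i\in B$. Let $(E,\Lambda,\pi)$ be a KSGNS-construction for $\varphi$: $E$ is a Hilbert C*-module over $B$; $\Lambda:\mathcal N_\varphi\to\mathcal L(B,E)$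 is linear, the vectors $\Lambda(a)b$ ($a\in\mathcal N_\varphi$, $b\in B$) span a dense subspace of $E$, and $\langle\Lambda(a_1)b_1,\Lambda(a_2)b_2\rangle=b_2^*\varphi(a_2^*a_1)b_1$; and $\pi:A\to\mathcal L(E)$ is a $*$-homomorphism with $\pi(x)\Lambda(a)=\Lambda(xa)$ for $x\in A$, $a\in\mathcal N_\varphi$. Let $\mathcal H_\varphi$ be the set of strict completely positive linear maps $\rho:A\to M(B)$ for which there is a (necessarily unique) $T_\rho\in\mathcal L(E)^+$ with $\langle T_\rho\Lambda(a_1)b_1,\Lambda(a_2)b_2\rangle=b_2^*\rho(a_2^*a_1)b_1$ for all $a_1,a_2\in\mathcal N_\varphi$, $b_1,b_2\in B$. Put $\mathcal F_\varphi=\{\rho\in\mathcal H_\varphi: T_\rho\le 1\}$ and $\mathcal G_\varphi=\{\lambda\rho:\lambda\in[0,1),\ \rho\in\mathcal F_\varphi\}$, ordered by $\rho_1\le\rho_2$ iff $\rho_2-\rho_1$ is completely positive (a directed set). Assume that $\varphi$ is lower semi-continuous: an element $x\in A^+$ belongs to $\mathcal M_\varphi^+$ if and only if the net $(\rho(x))_{\rho\in\mathcal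 G_\varphi}$ converges strictly in $M(B)$, and for every $x\in\mathcal M_\varphi^+$ this net converges strictly to $\varphi(x)$. Then: 1. $\Lambda$ is closed for the strict topology on $A$ and the strong topology on $L(B,E)$, i.e. the graph $\{(a,\Lambda(a)): a\in\mathcal N_\varphi\}$ is closed in $A\times L(B,E)$, where $A$ carries the strict topology (inherited from $M(A)$) and $L(B,E)$ the topology of pointwise norm convergence; 2. $\pi$ is non-degenerate, i.e. $\pi(A)E$ spans a dense subspace of $E$; 3. the net $(T_\rho)_{\rho\in\mathcal G_\varphi}$ converges strongly to $1$. -/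

import Mathlib

open scoped MultiplierAlgebra Topology
open Filter MulOpposite

noncomputable section

/-! ## Right Hilbert modules and adjointable operators

A right Hilbert C*-module over `B` is a complete `CStarModule Bᵐᵒᵖ E`: the right action of `b` is
`op b • x`, and Mathlib's inner product over `Bᵐᵒᵖ` is linear in the second variable, so that
`B`-valued inner product which is linear in the first variable is obtained by a flip. -/

section Hilbert

variable {B : Type*} [NonUnitalCStarAlgebra B] [PartialOrder B] [StarOrderedRing B]

/-- `B` as a right Hilbert module over itself: `x · a = x a`, `⟨x, y⟩ = y* x`. -/
instance selfRightCStarModule : CStarModule Bᵐᵒᵖ B where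
  inner x y := op (star x * y)
  inner_add_right := by intro x y z; simp [mul_add]
  inner_self_nonneg := by
    intro x
    rw [← op_zero]
    exact star_mul_self_nonneg x
  inner_self := by intro x; simp
  inner_op_smul_right := by
    intro a x y
    apply unop_injective
    simp [mul_assoc]
  inner_smul_right_complex := by
    intro z x y
    apply unop_injective
    simp [mul_smul_comm]
  star_inner := by intro x y; apply unop_injective; simp
  norm_eq_sqrt_norm_inner_self := by
    intro x
    change ‖x‖ = √‖star x * x‖
    rw [CStarRing.norm_star_mul_self, Real.sqrt_mul_self (norm_nonneg x)]

variable (B)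

variable {E : Type*} [NormedAddCommGroup E] [NormedSpace ℂ E] [SMul Bᵐᵒᵖ E] [CStarModule Bᵐᵒᵖ E]
  {F : Type*} [NormedAddCommGroup F] [NormedSpace ℂ F] [SMul Bᵐᵒᵖ F] [CStarModule Bᵐᵒᵖ F]

/-- The `B`-valued inner product `⟨x, y⟩` of a right Hilbert module,
linear in the first variable, with `⟨x b, y c⟩ = c* ⟨x, y⟩ b`. -/
def rinner (x y : E) : B := unop (inner Bᵐᵒᵖ y x)

theorem rinner_self_apply (b c : B) : rinner B b c = star c * b := rfl

variable {B} in
theorem rinner_star (x y : E) : star (rinner B x y) = rinner B y x := by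
  rw [rinner, rinner, ← unop_star, CStarModule.star_inner]

variable {B} in
theorem eq_of_rinner_left {x y : E} (h : ∀ z, rinner B x z = rinner B y z) : x = y := by
  rw [← sub_eq_zero, ← CStarModule.inner_self (A := Bᵐᵒᵖ), CStarModule.inner_sub_right, sub_eq_zero]
  exact unop_injective (h (x - y))

/-- `T` is adjointable. -/
def IsAdjointable (T : E →L[ℂ] F) : Prop :=
  ∃ S : F →L[ℂ] E, ∀ x y, rinner B (T x) y = rinner B x (S y)

variable (E F)

/-- The adjointable operators `𝓛(E, F)`. -/
def AdjointableHom : Submodule ℂ (E →L[ℂ] F) where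
  carrier := {T | IsAdjointable B T}
  zero_mem' := ⟨0, fun x y => by simp [rinner]⟩
  add_mem' := by
    rintro T₁ T₂ ⟨S₁, h₁⟩ ⟨S₂, h₂⟩
    refine ⟨S₁ + S₂, fun x y => ?_⟩
    have h₁ := h₁ x y
    have h₂ := h₂ x y
    simp only [rinner] at h₁ h₂ ⊢
    simp [h₁, h₂]
  smul_mem' := by
    rintro c T ⟨S, h⟩
    refine ⟨star c • S, fun x y => ?_⟩
    have h := h x y
    simp only [rinner] at h ⊢
    simp [h]

/-- The algebra `𝓛(E)` of adjointable operators on `E`. -/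
def AdjointableEnd : Subalgebra ℂ (E →L[ℂ] E) where
  carrier := {T | IsAdjointable B T}
  add_mem' := (AdjointableHom B E E).add_mem'
  mul_mem' := by
    rintro T₁ T₂ ⟨S₁, h₁⟩ ⟨S₂, h₂⟩
    exact ⟨S₂ * S₁, fun x y => by
      rw [mul_apply_eq_comp, h₁, h₂, mul_apply_eq_comp]⟩
  algebraMap_mem' := by
    intro c
    rw [Algebra.algebraMap_eq_smul_one]
    exact (AdjointableHom B E E).smul_mem c ⟨1, fun x y => rfl⟩

variable {B E}

namespace AdjointableEnd

/-- The adjoint of an adjointable operator. -/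
instance : Star (AdjointableEnd B E) where
  star T := ⟨Classical.choose (show IsAdjointable B T.1 from T.2), T.1, fun x y => by
    have h := Classical.choose_spec (show IsAdjointable B T.1 from T.2) y x
    rw [← rinner_star, ← h, rinner_star]⟩

theorem rinner_apply_left (T : AdjointableEnd B E) (x y : E) :
    rinner B (T.1 x) y = rinner B x ((star T).1 y) :=
  Classical.choose_spec (show IsAdjointable B T.1 from T.2) x y

theorem rinner_apply_right (T : AdjointableEnd B E) (x y : E) :
    rinner B x (T.1 y) = rinner B ((star T).1 x) y := by
  rw [← rinner_star, rinner_apply_left, rinner_star]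

theorem ext_rinner {S T : AdjointableEnd B E}
    (h : ∀ x y, rinner B (S.1 x) y = rinner B (T.1 x) y) : S = T :=
  Subtype.ext (ContinuousLinearMap.ext fun x => eq_of_rinner_left (h x))

instance : StarRing (AdjointableEnd B E) where
  star_involutive T := ext_rinner fun x y => by
    rw [← rinner_apply_right, ← rinner_apply_left]
  star_mul S T := ext_rinner fun x y => by
    rw [← rinner_apply_right]
    change rinner B x (S.1 (T.1 y)) = rinner B ((star T).1 ((star S).1 x)) y
    rw [rinner_apply_right, rinner_apply_right]
  star_add S T := ext_rinner fun x y => by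
    rw [← rinner_apply_right]
    have hS := rinner_apply_right S x y
    have hT := rinner_apply_right T x y
    simp only [rinner] at hS hT ⊢
    simp [hS, hT]

instance : StarModule ℂ (AdjointableEnd B E) where
  star_smul c T := ext_rinner fun x y => by
    rw [← rinner_apply_right]
    have hT := rinner_apply_right T x y
    simp only [rinner] at hT ⊢
    simp [hT]

/-- Positivity in the C*-algebra `𝓛(E)`: `T = X* X` for some `X ∈ 𝓛(E)`. -/
def IsPos (T : AdjointableEnd B E) : Prop := ∃ X : AdjointableEnd B E, T = star X * X

end AdjointableEnd

end Hilbert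

/-! ## Strict and strong topologies -/

/-- The strict topology on `M(B)`: `mᵢ → m` iff `mᵢ c → m c` and `c mᵢ → c m` for all `c ∈ B`. -/
abbrev strictTopology (B : Type*) [NonUnitalCStarAlgebra B] : TopologicalSpace 𝓜(ℂ, B) :=
  TopologicalSpace.induced
    (fun m => ((fun c => m.fst c, fun c => m.snd c) : (B → B) × (B → B))) inferInstance

/-- The strict topology on `A`, inherited from the inclusion `A ⊆ M(A)`. -/
abbrev strictTopologyOn (A : Type*) [NonUnitalCStarAlgebra A] : TopologicalSpace A :=
  TopologicalSpace.induced (fun a => (a : 𝓜(ℂ, A))) (strictTopology A)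

/-- The strong topology (pointwise norm convergence) on the space `L(B, E)` of all linear maps. -/
abbrev strongTopology (B E : Type*) [NonUnitalCStarAlgebra B]
    [NormedAddCommGroup E] [NormedSpace ℂ E] : TopologicalSpace (B →ₗ[ℂ] E) :=
  TopologicalSpace.induced (fun t => (t : B → E)) inferInstance

/-! ## Strict completely positive maps -/

section CP

variable {A B : Type*} [NonUnitalCStarAlgebra A] [NonUnitalCStarAlgebra B] [PartialOrder B]

/-- A linear map `ρ : A → M(B)` is completely positive:
`∑ᵢⱼ bⱼ* ρ(aⱼ* aᵢ) bᵢ ≥ 0` for all finite families in `A` and `B`. -/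
def IsCP (ρ : A →ₗ[ℂ] 𝓜(ℂ, B)) : Prop :=
  ∀ (n : ℕ) (a : Fin n → A) (b : Fin n → B),
    0 ≤ ∑ i, ∑ j, star (b j) * (ρ (star (a j) * a i)).fst (b i)

/-- `ρ` is strict: strictly continuous on (norm-)bounded sets. -/
def IsStrict (ρ : A →ₗ[ℂ] 𝓜(ℂ, B)) : Prop :=
  ∀ s : Set A, Bornology.IsBounded s →
    @ContinuousOn A 𝓜(ℂ, B) (strictTopologyOn A) (strictTopology B) ρ s

theorem IsCP.zero [StarOrderedRing B] : IsCP (0 : A →ₗ[ℂ] 𝓜(ℂ, B)) := by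
  intro n a b
  simp

theorem IsCP.add [StarOrderedRing B] {ρ σ : A →ₗ[ℂ] 𝓜(ℂ, B)} (hρ : IsCP ρ) (hσ : IsCP σ) :
    IsCP (ρ + σ) := by
  intro n a b
  have := add_nonneg (hρ n a b) (hσ n a b)
  simpa [mul_add, Finset.sum_add_distrib] using this

theorem IsCP.smul [StarOrderedRing B] {ρ : A →ₗ[ℂ] 𝓜(ℂ, B)} (hρ : IsCP ρ) {c : ℝ} (hc : 0 ≤ c) :
    IsCP ((c : ℂ) • ρ) := by
  intro n a b
  have := smul_nonneg hc (hρ n a b)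
  simpa [Finset.smul_sum, mul_smul_comm] using this

theorem IsStrict.smul {ρ : A →ₗ[ℂ] 𝓜(ℂ, B)} (hρ : IsStrict ρ) (c : ℂ) : IsStrict (c • ρ) := by
  intro s hs
  let _ := strictTopologyOn A
  let _ := strictTopology B
  have hc : Continuous fun m : 𝓜(ℂ, B) => c • m := by
    refine continuous_induced_rng.2 ?_
    have h : Continuous fun m : 𝓜(ℂ, B) =>
        ((fun x => m.fst x, fun x => m.snd x) : (B → B) × (B → B)) := continuous_induced_dom
    exact h.const_smul c
  exact hc.comp_continuousOn (hρ s hs)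

end CP

/-! ## C*-valued weights -/

/-- A hereditary cone in `A⁺`. -/
structure HereditaryCone (A : Type*) [NonUnitalCStarAlgebra A] [PartialOrder A] where
  carrier : Set A
  nonneg' : ∀ x ∈ carrier, 0 ≤ x
  zero_mem' : 0 ∈ carrier
  add_mem' : ∀ x ∈ carrier, ∀ y ∈ carrier, x + y ∈ carrier
  smul_mem' : ∀ r : ℝ, 0 ≤ r → ∀ x ∈ carrier, r • x ∈ carrier
  hereditary' : ∀ x y : A, 0 ≤ x → x ≤ y → y ∈ carrier → x ∈ carrier

namespace HereditaryCone

variable {A : Type*} [NonUnitalCStarAlgebra A] [PartialOrder A] [StarOrderedRing A]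

/-- `𝓝 = {a | a* a ∈ P}`, a left ideal of `A`. -/
def leftIdeal (P : HereditaryCone A) : Submodule ℂ A where
  carrier := {a | star a * a ∈ P.carrier}
  zero_mem' := by simpa using P.zero_mem'
  add_mem' := by
    intro a b ha hb
    refine P.hereditary' _ _ (star_mul_self_nonneg _) ?_
      (P.smul_mem' 2 zero_le_two _ (P.add_mem' _ ha _ hb))
    rw [← sub_nonneg]
    have h : (2 : ℝ) • (star a * a + star b * b) - star (a + b) * (a + b)
        = star (a - b) * (a - b) := by
      simp only [star_add, star_sub, add_mul, mul_add, sub_mul, mul_sub, two_smul]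
      abel
    rw [h]
    exact star_mul_self_nonneg _
  smul_mem' := by
    intro c a ha
    have h : star (c • a) * (c • a) = (‖c‖ ^ 2 : ℝ) • (star a * a) := by
      have hc : star c * c = ((‖c‖ ^ 2 : ℝ) : ℂ) := by
        rw [Complex.star_def, Complex.conj_mul']
        norm_cast
      rw [star_smul, smul_mul_smul_comm, hc, Complex.coe_smul]
    change star (c • a) * (c • a) ∈ P.carrier
    rw [h]
    exact P.smul_mem' _ (sq_nonneg _) _ ha

theorem mem_leftIdeal {P : HereditaryCone A} {a : A} :
    a ∈ P.leftIdeal ↔ star a * a ∈ P.carrier := Iff.rfl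

theorem mul_mem_leftIdeal (P : HereditaryCone A) (x : A) {a : A} (ha : a ∈ P.leftIdeal) :
    x * a ∈ P.leftIdeal := by
  refine P.hereditary' _ _ (star_mul_self_nonneg _) ?_
    (P.smul_mem' ‖star x * x‖ (norm_nonneg _) _ ha)
  rw [star_mul, mul_assoc, ← mul_assoc (star x), ← mul_assoc]
  exact CStarAlgebra.star_left_conjugate_le_norm_smul (IsSelfAdjoint.star_mul_self x)

/-- `𝓜 = span P`. -/
def linearSpan (P : HereditaryCone A) : Submodule ℂ A := Submodule.span ℂ P.carrier

theorem star_mul_mem_linearSpan (P : HereditaryCone A) {a b : A}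
    (ha : a ∈ P.leftIdeal) (hb : b ∈ P.leftIdeal) : star b * a ∈ P.linearSpan := by
  have key : ∀ c : ℂ, star (a + c • b) * (a + c • b) ∈ P.linearSpan := fun c =>
    Submodule.subset_span (P.leftIdeal.add_mem ha (P.leftIdeal.smul_mem c hb))
  have h : star b * a = (4 : ℂ)⁻¹ • (star (a + (1 : ℂ) • b) * (a + (1 : ℂ) • b)
      - star (a + (-1 : ℂ) • b) * (a + (-1 : ℂ) • b)
      + Complex.I • (star (a + Complex.I • b) * (a + Complex.I • b))
      - Complex.I • (star (a + (-Complex.I) • b) * (a + (-Complex.I) • b))) := by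
    rw [eq_inv_smul_iff₀ (by norm_num)]
    simp only [star_add, star_smul, star_neg, star_one, Complex.star_def, Complex.conj_I,
      add_mul, mul_add, smul_mul_assoc, mul_smul_comm, smul_add, smul_smul]
    ring_nf
    simp only [Complex.I_sq, pow_three', Complex.I_mul_I]
    module
  rw [h]
  exact P.linearSpan.smul_mem _ (P.linearSpan.sub_mem (P.linearSpan.add_mem
    (P.linearSpan.sub_mem (key _) (key _)) (P.linearSpan.smul_mem _ (key _)))
    (P.linearSpan.smul_mem _ (key _)))

/-- The positive elements of `𝓜 = span P` are exactly the elements of `P`. -/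
theorem mem_carrier_iff (P : HereditaryCone A) {x : A} :
    x ∈ P.carrier ↔ x ∈ P.linearSpan ∧ 0 ≤ x := by
  refine ⟨fun h => ⟨Submodule.subset_span h, P.nonneg' x h⟩, fun ⟨hx, h0⟩ => ?_⟩
  have key : ∀ y ∈ P.linearSpan, ∀ c : ℂ, ∃ p ∈ P.carrier, c • y + star (c • y) ≤ p := by
    intro y hy
    induction hy using Submodule.span_induction with
    | mem y hy =>
      intro c
      refine ⟨(2 * |c.re|) • y, P.smul_mem' _ (by positivity) _ hy, ?_⟩
      have hs : star y = y := (P.nonneg' y hy).isSelfAdjoint.star_eq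
      have hc : c + star c = ((2 * c.re : ℝ) : ℂ) := Complex.add_conj c
      rw [star_smul, hs, ← add_smul, hc, Complex.coe_smul, ← sub_nonneg, ← sub_smul]
      exact smul_nonneg (by linarith [le_abs_self c.re]) (P.nonneg' y hy)
    | zero => exact fun c => ⟨0, P.zero_mem', by simp⟩
    | add y z _ _ ihy ihz =>
      intro c
      obtain ⟨p, hp, hyp⟩ := ihy c
      obtain ⟨q, hq, hzq⟩ := ihz c
      refine ⟨p + q, P.add_mem' _ hp _ hq, ?_⟩
      have h := add_le_add hyp hzq
      rw [smul_add, star_add]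
      rwa [add_add_add_comm] at h
    | smul d y _ ih =>
      intro c
      rw [smul_smul]
      exact ih (c * d)
  obtain ⟨p, hp, hxp⟩ := key x hx 1
  rw [one_smul, h0.isSelfAdjoint.star_eq] at hxp
  exact P.hereditary' x p h0 (le_trans (le_add_of_nonneg_left h0) hxp) hp

end HereditaryCone

/-- A C*-valued weight from `A` into `M(B)`: a linear map `φ : 𝓜 → M(B)` on the span of a
hereditary cone, satisfying complete positivity. -/
structure CStarWeight (A B : Type*) [NonUnitalCStarAlgebra A] [PartialOrder A] [StarOrderedRing A]
    [NonUnitalCStarAlgebra B] [PartialOrder B] where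
  /-- The cone `𝓜_φ⁺`. -/
  cone : HereditaryCone A
  toLin : cone.linearSpan →ₗ[ℂ] 𝓜(ℂ, B)
  positive' : ∀ (n : ℕ) (a : Fin n → cone.leftIdeal) (b : Fin n → B),
    0 ≤ ∑ i, ∑ j, star (b j) *
      (toLin ⟨star (a j : A) * (a i : A),
        cone.star_mul_mem_linearSpan (a i).2 (a j).2⟩).fst (b i)

namespace CStarWeight

variable {A B : Type*} [NonUnitalCStarAlgebra A] [PartialOrder A] [StarOrderedRing A]
  [NonUnitalCStarAlgebra B] [PartialOrder B]

/-- `𝓜_φ`, the domain of `φ`. -/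
abbrev dom (φ : CStarWeight A B) : Submodule ℂ A := φ.cone.linearSpan

/-- `𝓝_φ = {a | a* a ∈ 𝓜_φ⁺}`. -/
abbrev N (φ : CStarWeight A B) : Submodule ℂ A := φ.cone.leftIdeal

/-- `φ(c* a)` for `a, c ∈ 𝓝_φ`. -/
def form (φ : CStarWeight A B) (c a : φ.N) : 𝓜(ℂ, B) :=
  φ.toLin ⟨star (c : A) * (a : A), φ.cone.star_mul_mem_linearSpan a.2 c.2⟩

/-- `φ` is densely defined. -/
def IsDenselyDefined (φ : CStarWeight A B) : Prop := Dense (φ.dom : Set A)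

end CStarWeight

/-- A KSGNS-construction `(E, Λ, π)` for `φ` on the Hilbert module `E`. -/
structure KSGNS {A B : Type*} [NonUnitalCStarAlgebra A] [PartialOrder A] [StarOrderedRing A]
    [NonUnitalCStarAlgebra B] [PartialOrder B] [StarOrderedRing B] (φ : CStarWeight A B)
    (E : Type*) [NormedAddCommGroup E] [NormedSpace ℂ E] [SMul Bᵐᵒᵖ E] [CStarModule Bᵐᵒᵖ E] where
  /-- `Λ : 𝓝_φ → 𝓛(B, E)`. -/
  Λ : φ.N →ₗ[ℂ] AdjointableHom B B E
  /-- `π : A → 𝓛(E)`. -/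
  π : A →⋆ₙₐ[ℂ] AdjointableEnd B E
  dense' : Dense (Submodule.span ℂ {v : E | ∃ (a : φ.N) (b : B), v = (Λ a).1 b} : Set E)
  inner' : ∀ (a₁ a₂ : φ.N) (b₁ b₂ : B),
    rinner B ((Λ a₁).1 b₁) ((Λ a₂).1 b₂) = star b₂ * (φ.form a₂ a₁).fst b₁
  map_mul' : ∀ (x : A) (a : φ.N),
    (π x).1.comp (Λ a).1 = (Λ ⟨x * a, φ.cone.mul_mem_leftIdeal x a.2⟩).1

namespace KSGNS

variable {A B E : Type*} [NonUnitalCStarAlgebra A] [PartialOrder A] [StarOrderedRing A]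
  [NonUnitalCStarAlgebra B] [PartialOrder B] [StarOrderedRing B] {φ : CStarWeight A B}
  [NormedAddCommGroup E] [NormedSpace ℂ E] [SMul Bᵐᵒᵖ E] [CStarModule Bᵐᵒᵖ E]

/-- `T ∈ 𝓛(E)` implements `ρ`: for all `a₁, a₂ ∈ 𝓝_φ` and `b₁, b₂ ∈ B`,
`⟨T Λ(a₁) b₁, Λ(a₂) b₂⟩ = b₂* ρ(a₂* a₁) b₁`. -/
def Implements (K : KSGNS φ E) (T : AdjointableEnd B E) (ρ : A →ₗ[ℂ] 𝓜(ℂ, B)) : Prop :=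
  ∀ (a₁ a₂ : φ.N) (b₁ b₂ : B),
    rinner B (T.1 ((K.Λ a₁).1 b₁)) ((K.Λ a₂).1 b₂)
      = star b₂ * (ρ (star (a₂ : A) * (a₁ : A))).fst b₁

/-- `𝓗_φ`: the strict completely positive maps implemented by some `T ∈ 𝓛(E)⁺`. -/
def H (K : KSGNS φ E) : Set (A →ₗ[ℂ] 𝓜(ℂ, B)) :=
  {ρ | IsStrict ρ ∧ IsCP ρ ∧ ∃ T : AdjointableEnd B E, AdjointableEnd.IsPos T ∧ K.Implements T ρ}

/-- The operator `T_ρ ∈ 𝓛(E)⁺` implementing `ρ ∈ 𝓗_φ`; it is unique, as the vectors `Λ(a) b`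
span a dense subspace. -/
def T (K : KSGNS φ E) (ρ : A →ₗ[ℂ] 𝓜(ℂ, B)) (hρ : ρ ∈ K.H) : AdjointableEnd B E :=
  hρ.2.2.choose

theorem T_spec (K : KSGNS φ E) (ρ : A →ₗ[ℂ] 𝓜(ℂ, B)) (hρ : ρ ∈ K.H) :
    AdjointableEnd.IsPos (K.T ρ hρ) ∧ K.Implements (K.T ρ hρ) ρ :=
  hρ.2.2.choose_spec

/-- `𝓕_φ = {ρ ∈ 𝓗_φ | T_ρ ≤ 1}`. -/
def F (K : KSGNS φ E) : Set (A →ₗ[ℂ] 𝓜(ℂ, B)) :=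
  {ρ | ∃ hρ : ρ ∈ K.H, AdjointableEnd.IsPos (1 - K.T ρ hρ)}

/-- `𝓖_φ = {λ ρ | λ ∈ [0, 1), ρ ∈ 𝓕_φ}`. -/
def G (K : KSGNS φ E) : Set (A →ₗ[ℂ] 𝓜(ℂ, B)) :=
  {σ | ∃ c : ℝ, 0 ≤ c ∧ c < 1 ∧ ∃ ρ ∈ K.F, σ = (c : ℂ) • ρ}

theorem G_subset_H (K : KSGNS φ E) : K.G ⊆ K.H := by
  rintro _ ⟨c, hc0, -, ρ, ⟨⟨hs, hcp, T, ⟨X, hX⟩, hT⟩, -⟩, rfl⟩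
  refine ⟨hs.smul c, hcp.smul hc0, (c : ℂ) • T, ⟨((√c : ℝ) : ℂ) • X, ?_⟩, ?_⟩
  · rw [star_smul, smul_mul_smul_comm, hX, Complex.star_def, Complex.conj_ofReal,
      ← Complex.ofReal_mul, Real.mul_self_sqrt hc0]
  · intro a₁ a₂ b₁ b₂
    have h := hT a₁ a₂ b₁ b₂
    have h2 : rinner B (((c : ℂ) • T).1 ((K.Λ a₁).1 b₁)) ((K.Λ a₂).1 b₂)
        = (c : ℂ) • rinner B (T.1 ((K.Λ a₁).1 b₁)) ((K.Λ a₂).1 b₂) := by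
      simp [rinner]
    rw [h2, h]
    simp [mul_smul_comm]

/-- `𝓖_φ` is ordered by: `ρ ≤ σ` iff `σ - ρ` is completely positive. The net
`(ρ)_{ρ ∈ 𝓖_φ}` is indexed by this order. -/
instance (K : KSGNS φ E) : Preorder K.G where
  le ρ σ := IsCP (σ.1 - ρ.1)
  le_refl ρ := by
    rw [sub_self]
    exact IsCP.zero
  le_trans ρ σ τ h₁ h₂ := by
    have h := h₂.add h₁
    rwa [sub_add_sub_cancel] at h

/-- Lower semi-continuity of the weight `φ`, in terms of the net `𝓖_φ`:
an element `x ∈ A⁺` lies in `𝓜_φ⁺` iff `(ρ(x))_ρ` converges strictly in `M(B)`, and in that case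
the strict limit is `φ(x)`. -/
def IsLowerSemicontinuous (K : KSGNS φ E) : Prop :=
  (∀ x : A, 0 ≤ x → (x ∈ φ.cone.carrier ↔
    ∃ m : 𝓜(ℂ, B), Tendsto (fun ρ : K.G => ρ.1 x) atTop (@nhds _ (strictTopology B) m))) ∧
  ∀ (x : A) (hx : x ∈ φ.cone.carrier),
    Tendsto (fun ρ : K.G => ρ.1 x) atTop
      (@nhds _ (strictTopology B) (φ.toLin ⟨x, Submodule.subset_span hx⟩))

/-- The graph of `Λ`, as a subset of `A × L(B, E)`. -/
def graph (K : KSGNS φ E) : Set (A × (B →ₗ[ℂ] E)) :=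
  {p | ∃ a : φ.N, p = ((a : A), ((K.Λ a).1 : B →ₗ[ℂ] E))}

/-- `Λ` is closed for the strict topology on `A` and the strong topology on `L(B, E)`. -/
def LambdaIsClosed (K : KSGNS φ E) : Prop :=
  @IsClosed (A × (B →ₗ[ℂ] E))
    (@instTopologicalSpaceProd A (B →ₗ[ℂ] E) (strictTopologyOn A) (strongTopology B E)) K.graph

/-- `π` is non-degenerate: `π(A) E` spans a dense subspace of `E`. -/
def IsNondegenerate (K : KSGNS φ E) : Prop :=
  Dense (Submodule.span ℂ {w : E | ∃ (x : A) (v : E), w = (K.π x).1 v} : Set E)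

end KSGNS

end

/-! Everything rests on `tendsto_T`. Lower semi-continuity gives ⟨T_ρ Λ(a)b, Λ(a)b⟩ → ⟨Λ(a)b,
Λ(a)b⟩, and because 0 ≤ 1 - T_ρ ≤ 1, convergence of these forms forces T_ρ → 1 strongly. The other
two claims hold first behind a T_ρ, where Λ is tame because the coefficients d* ρ(·) b are norm
continuous; letting T_ρ → 1 then removes the T_ρ.

For non-degeneracy, T_ρ commutes with π(A) and T_ρ Λ(ea)b → T_ρ Λ(a)b along an approximate unit
(`Implements.tendsto_π`). For closedness, suppose aᵢ → a strictly and Λ(aᵢ) → t pointwise. Then ⟨T_ρ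
t b, t d⟩ = d* ρ(a*a) b, so T_ρ → 1 makes ρ(a*a) converge strictly. Lower semi-continuity puts a in
𝓝_φ, and T_ρ Λ(a) = T_ρ t for every ρ (`exists_Λ_eq_of_tendsto`).

These limits say something only if `atTop` on 𝓖_φ is proper, that is, if 𝓖_φ is directed. If it were
not, every net over it would converge to everything, and lower semi-continuity would make φ
everywhere defined. In that case Λ is bounded and 𝓖_φ can be shown to be directed
(`neBot_atTop_of_forall_mem`): T ↦ (1 - T)⁻¹ turns upper bounds into sums, and `HasVectors`
describes strictness of ρ by a property of T_ρ that survives these operations. -/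

noncomputable section

set_option linter.unusedSectionVars false

/-! ### Inner product calculus in right Hilbert modules. -/

section RInner

variable {B : Type*} [NonUnitalCStarAlgebra B] [PartialOrder B] [StarOrderedRing B]
  {E : Type*} [NormedAddCommGroup E] [NormedSpace ℂ E] [SMul Bᵐᵒᵖ E] [CStarModule Bᵐᵒᵖ E]

theorem rinner_add_right (x y z : E) : rinner B x (y + z) = rinner B x y + rinner B x z := by
  simp [rinner]

theorem rinner_sub_left (x y z : E) : rinner B (x - y) z = rinner B x z - rinner B y z := by
  simp [rinner]

theorem rinner_sub_right (x y z : E) : rinner B x (y - z) = rinner B x y - rinner B x z := by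
  simp [rinner]

theorem rinner_smul_left (c : ℂ) (x y : E) : rinner B (c • x) y = c • rinner B x y := by
  simp [rinner]

theorem rinner_sum_left {ι : Type*} (s : Finset ι) (x : ι → E) (y : E) :
    rinner B (∑ i ∈ s, x i) y = ∑ i ∈ s, rinner B (x i) y := by
  simp [rinner, CStarModule.inner_sum_right]

theorem rinner_sum_right {ι : Type*} (s : Finset ι) (x : E) (y : ι → E) :
    rinner B x (∑ i ∈ s, y i) = ∑ i ∈ s, rinner B x (y i) := by
  simp [rinner, CStarModule.inner_sum_left]

theorem norm_rinner_le (x y : E) : ‖rinner B x y‖ ≤ ‖x‖ * ‖y‖ := by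
  rw [rinner, MulOpposite.norm_unop, mul_comm]
  exact CStarModule.norm_inner_le E

theorem norm_rinner_self (x : E) : ‖rinner B x x‖ = ‖x‖ ^ 2 := by
  rw [rinner, MulOpposite.norm_unop]
  exact (CStarModule.norm_sq_eq Bᵐᵒᵖ).symm

theorem rinner_self_nonneg (x : E) : 0 ≤ rinner B x x := by
  have h : (0 : Bᵐᵒᵖ) ≤ inner Bᵐᵒᵖ x x := CStarModule.inner_self_nonneg
  exact h

theorem continuous_rinner : Continuous fun p : E × E => rinner B p.1 p.2 :=
  MulOpposite.continuous_unop.comp (CStarModule.continuous_inner.comp continuous_swap)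

theorem Filter.Tendsto.rinner {α : Type*} {l : Filter α} {f g : α → E} {x y : E}
    (hf : Tendsto f l (𝓝 x)) (hg : Tendsto g l (𝓝 y)) :
    Tendsto (fun a => rinner B (f a) (g a)) l (𝓝 (rinner B x y)) :=
  (continuous_rinner.tendsto (x, y)).comp (hf.prodMk_nhds hg)

/-- Vectors with equal inner products against a subset spanning a dense subspace are equal. -/
theorem eq_of_rinner_span {s : Set E} (hs : Dense (Submodule.span ℂ s : Set E)) {x y : E}
    (h : ∀ z ∈ s, rinner B x z = rinner B y z) : x = y := by
  refine eq_of_rinner_left (B := B) fun z => ?_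
  have hz : ∀ z ∈ Submodule.span ℂ s, rinner B x z = rinner B y z := by
    intro z hz
    induction hz using Submodule.span_induction with
    | mem z hz => exact h z hz
    | zero => simp [rinner]
    | add u v _ _ hu hv => rw [rinner_add_right, rinner_add_right, hu, hv]
    | smul c u _ hu =>
      rw [← rinner_star, rinner_smul_left, star_smul, rinner_star, hu, ← rinner_star (c • u),
        rinner_smul_left, star_smul, rinner_star]
  have hc (x : E) : Continuous fun z => rinner B x z :=
    continuous_rinner.comp (Continuous.prodMk continuous_const continuous_id)
  exact congrFun ((hc x).ext_on hs (hc y) hz) z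

theorem eq_of_star_mul_eq {x y : B} (h : ∀ d, star d * x = star d * y) : x = y :=
  eq_of_rinner_left (B := B) fun z => h z

theorem norm_le_of_norm_star_mul_self_le {y : B} {C : ℝ} (hC : 0 ≤ C)
    (h : ‖star y * y‖ ≤ C * ‖y‖) : ‖y‖ ≤ C := by
  rw [CStarRing.norm_star_mul_self] at h
  rcases (norm_nonneg y).eq_or_lt with hy | hy
  · rwa [← hy]
  · exact le_of_mul_le_mul_right h hy

end RInner

/-! ### 𝓛(E) as a unital C*-algebra. -/

namespace AdjointableEnd

variable {B : Type*} [NonUnitalCStarAlgebra B] [PartialOrder B] [StarOrderedRing B]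
  {E : Type*} [NormedAddCommGroup E] [NormedSpace ℂ E] [SMul Bᵐᵒᵖ E] [CStarModule Bᵐᵒᵖ E]

@[simp] theorem mul_apply (S T : AdjointableEnd B E) (x : E) : (S * T).1 x = S.1 (T.1 x) := rfl
@[simp] theorem one_apply (x : E) : (1 : AdjointableEnd B E).1 x = x := rfl
@[simp] theorem sub_apply (S T : AdjointableEnd B E) (x : E) : (S - T).1 x = S.1 x - T.1 x := rfl
@[simp] theorem add_apply (S T : AdjointableEnd B E) (x : E) : (S + T).1 x = S.1 x + T.1 x := rfl
@[simp] theorem smul_apply (c : ℂ) (T : AdjointableEnd B E) (x : E) :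
    (c • T).1 x = c • T.1 x := rfl

theorem norm_apply_le (T : AdjointableEnd B E) (x : E) : ‖T.1 x‖ ≤ ‖T‖ * ‖x‖ :=
  T.1.le_opNorm x

theorem norm_mul_norm_le (T : AdjointableEnd B E) : ‖T‖ * ‖T‖ ≤ ‖star T * T‖ := by
    have h : ‖T.1‖ ≤ √‖star T * T‖ := by
      refine T.1.opNorm_le_bound (Real.sqrt_nonneg _) fun x => ?_
      have hx : √‖star T * T‖ * ‖x‖ = √(‖star T * T‖ * ‖x‖ ^ 2) := by
        rw [Real.sqrt_mul' _ (sq_nonneg _), Real.sqrt_sq (norm_nonneg x)]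
      rw [hx]
      refine Real.le_sqrt_of_sq_le ?_
      rw [← norm_rinner_self (B := B), rinner_apply_left]
      refine (norm_rinner_le _ _).trans ?_
      have := norm_apply_le (star T * T) x
      calc _ ≤ ‖x‖ * (‖star T * T‖ * ‖x‖) := by gcongr; exact this
        _ = _ := by ring
    calc ‖T‖ * ‖T‖ ≤ √‖star T * T‖ * √‖star T * T‖ := by gcongr <;> exact h
      _ = _ := Real.mul_self_sqrt (norm_nonneg _)

instance : CStarRing (AdjointableEnd B E) where
  norm_mul_self_le := norm_mul_norm_le

theorem norm_star_le (T : AdjointableEnd B E) : ‖star T‖ ≤ ‖T‖ := by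
  have h := (norm_mul_norm_le (star T)).trans (norm_mul_le _ _)
  rw [star_star] at h
  rcases (norm_nonneg (star T)).eq_or_lt with h0 | h0
  · rw [← h0]
    exact norm_nonneg T
  · exact le_of_mul_le_mul_right h h0

/-- The adjoint is contractive, so the adjoints of a Cauchy sequence are Cauchy too, and their limit
is an adjoint of the limit operator. -/
instance [CompleteSpace E] : CompleteSpace (AdjointableEnd B E) := by
  refine Metric.complete_of_cauchySeq_tendsto fun u hu => ?_
  have hu' : CauchySeq fun n => star (u n) := by
    rw [Metric.cauchySeq_iff] at hu ⊢
    intro ε hε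
    obtain ⟨N, hN⟩ := hu ε hε
    refine ⟨N, fun m hm n hn => ?_⟩
    have h : star (u m) - star (u n) = star (u m - u n) := (star_sub _ _).symm
    have := hN m hm n hn
    rw [dist_eq_norm] at this ⊢
    calc _ = ‖star (u m - u n)‖ := congrArg _ h
      _ ≤ ‖u m - u n‖ := norm_star_le _
      _ < ε := this
  have hval : ∀ w : ℕ → AdjointableEnd B E, CauchySeq w → CauchySeq fun n => (w n).1 :=
    fun w hw => hw.map uniformContinuous_subtype_val
  obtain ⟨T, hT⟩ := cauchySeq_tendsto_of_complete (hval _ hu)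
  obtain ⟨S, hS⟩ := cauchySeq_tendsto_of_complete (hval _ hu')
  have happ {w : ℕ → E →L[ℂ] E} {T} (hw : Tendsto w atTop (𝓝 T)) (x : E) :
      Tendsto (fun n => w n x) atTop (𝓝 (T x)) :=
    ((ContinuousLinearMap.apply ℂ E x).continuous.tendsto T).comp hw
  refine ⟨⟨T, S, fun x y => ?_⟩, tendsto_subtype_rng.2 hT⟩
  refine tendsto_nhds_unique ((happ hT x).rinner (B := B) (tendsto_const_nhds (x := y))) ?_
  simp_rw [rinner_apply_left]
  exact (tendsto_const_nhds (x := x)).rinner (happ hS y)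

variable [CompleteSpace E]

instance : CStarAlgebra (AdjointableEnd B E) where

instance : PartialOrder (AdjointableEnd B E) := CStarAlgebra.spectralOrder _

instance : StarOrderedRing (AdjointableEnd B E) := CStarAlgebra.spectralOrderedRing _

theorem isPos_iff_nonneg {T : AdjointableEnd B E} : IsPos T ↔ 0 ≤ T := by
  rw [CStarAlgebra.nonneg_iff_eq_star_mul_self]
  rfl

theorem rinner_nonneg {T : AdjointableEnd B E} (hT : 0 ≤ T) (x : E) :
    0 ≤ rinner B (T.1 x) x := by
  obtain ⟨X, rfl⟩ := isPos_iff_nonneg.2 hT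
  rw [rinner_apply_left, star_mul, star_star, mul_apply, ← rinner_apply_left]
  exact rinner_self_nonneg _

/-- With T = X*X this is ‖X*Xx‖² ≤ ‖X*‖² ‖Xx‖². It turns smallness of the quadratic form of T into
smallness of vectors. -/
theorem norm_apply_sq_le {T : AdjointableEnd B E} (hT : 0 ≤ T) (x : E) :
    ‖T.1 x‖ ^ 2 ≤ ‖T‖ * ‖rinner B (T.1 x) x‖ := by
  obtain ⟨X, rfl⟩ := isPos_iff_nonneg.2 hT
  have h : rinner B ((star X * X).1 x) x = rinner B (X.1 x) (X.1 x) := by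
    rw [rinner_apply_left, star_mul, star_star, mul_apply, ← rinner_apply_left]
  rw [h, norm_rinner_self, CStarRing.norm_star_mul_self, mul_apply]
  calc _ ≤ (‖star X‖ * ‖X.1 x‖) ^ 2 := by gcongr; exact norm_apply_le _ _
    _ = _ := by rw [norm_star]; ring

end AdjointableEnd

/-- A bounded family of operators which converges on a set spanning a dense subspace converges
strongly. -/
theorem ContinuousLinearMap.tendsto_of_dense_span {ι E F : Type*} [NormedAddCommGroup E]
    [NormedSpace ℂ E] [NormedAddCommGroup F] [NormedSpace ℂ F] {l : Filter ι}
    {f : ι → E →L[ℂ] F} {g : E →L[ℂ] F} {C : ℝ} (hC : ∀ᶠ i in l, ‖f i‖ ≤ C) {s : Set E}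
    (hs : Dense (Submodule.span ℂ s : Set E)) (h : ∀ v ∈ s, Tendsto (fun i => f i v) l (𝓝 (g v)))
    (v : E) : Tendsto (fun i => f i v) l (𝓝 (g v)) := by
  have hspan : ∀ v ∈ Submodule.span ℂ s, Tendsto (fun i => f i v) l (𝓝 (g v)) := by
    intro v hv
    induction hv using Submodule.span_induction with
    | mem v hv => exact h v hv
    | zero => simpa using tendsto_const_nhds
    | add u v _ _ hu hv => simpa using hu.add hv
    | smul c u _ hu => simpa using hu.const_smul c
  rw [Metric.tendsto_nhds]
  intro ε hε
  set D : ℝ := |C| + ‖g‖ + 1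
  have hD : 0 < D := by positivity
  obtain ⟨w, hw, hvw⟩ := Metric.mem_closure_iff.1 (hs v) (ε / (2 * D)) (by positivity)
  have hw' := Metric.tendsto_nhds.1 (hspan w hw) (ε / 2) (by positivity)
  filter_upwards [hC, hw'] with i hi hiw
  rw [dist_eq_norm] at hiw hvw ⊢
  have hdec : f i v - g v = (f i - g) (v - w) + (f i w - g w) := by
    simp only [sub_apply, map_sub]
    abel
  have h1 : ‖(f i - g) (v - w)‖ ≤ D * ‖v - w‖ := by
    refine ((f i - g).le_opNorm _).trans ?_
    gcongr
    refine (norm_sub_le _ _).trans ?_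
    have := le_abs_self C
    simp only [D]
    linarith
  have h2 : D * ‖v - w‖ ≤ ε / 2 := by
    calc D * ‖v - w‖ ≤ D * (ε / (2 * D)) := by gcongr
      _ = ε / 2 := by field_simp
  rw [hdec]
  refine (norm_add_le _ _).trans_lt ?_
  linarith

/-! ### Norm continuity of matrix coefficients. -/

section CP

variable {A B : Type*} [NonUnitalCStarAlgebra A] [PartialOrder A] [StarOrderedRing A]
  [NonUnitalCStarAlgebra B] [PartialOrder B] [StarOrderedRing B]

theorem star_mul_clm_polarization (m : B →L[ℂ] B) (b d : B) :
    star d * m b = (4 : ℂ)⁻¹ • (star (b + d) * m (b + d) - star (b - d) * m (b - d)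
      + Complex.I • (star (b + Complex.I • d) * m (b + Complex.I • d))
      - Complex.I • (star (b - Complex.I • d) * m (b - Complex.I • d))) := by
  rw [eq_inv_smul_iff₀ (by norm_num)]
  simp only [star_add, star_sub, star_smul, Complex.star_def, Complex.conj_I, map_add, map_sub,
    map_smul, add_mul, mul_add, sub_mul, mul_sub, smul_mul_assoc, mul_smul_comm, smul_add,
    smul_sub, smul_smul]
  ring_nf
  simp only [Complex.I_sq, pow_three', Complex.I_mul_I]
  module

/-- The matrix coefficients of a map into `M(B)` with `b* f(a* a) b ≥ 0` are norm continuous. -/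
theorem continuous_star_mul_of_nonneg (f : A →ₗ[ℂ] 𝓜(ℂ, B))
    (hf : ∀ (a : A) (b : B), 0 ≤ star b * (f (star a * a)).fst b) (b d : B) :
    Continuous fun x => star d * (f x).fst b := by
  -- A diagonal coefficient is a positive linear map between C*-algebras, hence automatically
  -- bounded; polarization handles the others.
  have key (b : B) : Continuous fun x => star b * (f x).fst b := by
    let g : A →ₗ[ℂ] B :=
      { toFun x := star b * (f x).fst b
        map_add' x y := by simp [mul_add]
        map_smul' c x := by simp [mul_smul_comm] }
    have hg : ∀ x, 0 ≤ x → 0 ≤ g x := by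
      intro x hx
      obtain ⟨a, rfl⟩ := CStarAlgebra.nonneg_iff_eq_star_mul_self.1 hx
      exact hf a b
    exact map_continuous (PositiveLinearMap.mk₀ g hg)
  simp_rw [star_mul_clm_polarization _ b d]
  exact ((((key _).sub (key _)).add ((key _).const_smul _)).sub ((key _).const_smul _)).const_smul _

theorem IsCP.nonneg {ρ : A →ₗ[ℂ] 𝓜(ℂ, B)} (hρ : IsCP ρ) (a : A) (b : B) :
    0 ≤ star b * (ρ (star a * a)).fst b := by
  simpa using hρ 1 (fun _ => a) (fun _ => b)

theorem IsCP.continuous_star_mul {ρ : A →ₗ[ℂ] 𝓜(ℂ, B)} (hρ : IsCP ρ) (b d : B) :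
    Continuous fun x => star d * (ρ x).fst b :=
  continuous_star_mul_of_nonneg ρ hρ.nonneg b d

end CP

/-! ### The operators T_ρ and their strong convergence to 1. -/

namespace KSGNS

variable {A B E : Type*} [NonUnitalCStarAlgebra A] [PartialOrder A] [StarOrderedRing A]
  [NonUnitalCStarAlgebra B] [PartialOrder B] [StarOrderedRing B] {φ : CStarWeight A B}
  [NormedAddCommGroup E] [NormedSpace ℂ E] [SMul Bᵐᵒᵖ E] [CStarModule Bᵐᵒᵖ E]
  (K : KSGNS φ E)

theorem eq_of_rinner_Λ {x y : E}
    (h : ∀ (a : φ.N) (b : B), rinner B x ((K.Λ a).1 b) = rinner B y ((K.Λ a).1 b)) : x = y := by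
  refine eq_of_rinner_span (B := B) K.dense' ?_
  rintro _ ⟨a, b, rfl⟩
  exact h a b

theorem clm_ext {F : Type*} [NormedAddCommGroup F] [NormedSpace ℂ F] {S T : E →L[ℂ] F}
    (h : ∀ (a : φ.N) (b : B), S ((K.Λ a).1 b) = T ((K.Λ a).1 b)) : S = T := by
  refine ContinuousLinearMap.ext_on K.dense' ?_
  rintro _ ⟨a, b, rfl⟩
  exact h a b

variable {K} in
theorem Implements.unique {S T : AdjointableEnd B E} {ρ : A →ₗ[ℂ] 𝓜(ℂ, B)}
    (hS : K.Implements S ρ) (hT : K.Implements T ρ) : S = T := by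
  refine Subtype.ext (K.clm_ext fun a b => K.eq_of_rinner_Λ fun c d => ?_)
  rw [hS, hT]

variable {K} in
theorem Implements.smul {T : AdjointableEnd B E} {ρ : A →ₗ[ℂ] 𝓜(ℂ, B)}
    (hT : K.Implements T ρ) (c : ℂ) : K.Implements (c • T) (c • ρ) := by
  intro a₁ a₂ b₁ b₂
  rw [AdjointableEnd.smul_apply, rinner_smul_left, hT]
  simp [mul_smul_comm]

theorem π_apply_Λ (x : A) (a : φ.N) (b : B) :
    (K.π x).1 ((K.Λ a).1 b) = (K.Λ ⟨x * a, φ.cone.mul_mem_leftIdeal x a.2⟩).1 b :=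
  DFunLike.congr_fun (K.map_mul' x a) b

theorem rinner_π_left (x : A) (v w : E) :
    rinner B ((K.π x).1 v) w = rinner B v ((K.π (star x)).1 w) := by
  rw [AdjointableEnd.rinner_apply_left, map_star]

variable {K} in
/-- Operators implementing a map on `A` commute with `π(A)`. -/
theorem Implements.commute {T : AdjointableEnd B E} {ρ : A →ₗ[ℂ] 𝓜(ℂ, B)}
    (hT : K.Implements T ρ) (x : A) : T * K.π x = K.π x * T := by
  refine Subtype.ext (K.clm_ext fun a b => K.eq_of_rinner_Λ fun c d => ?_)
  change rinner B (T.1 ((K.π x).1 _)) _ = rinner B ((K.π x).1 (T.1 _)) _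
  rw [rinner_π_left, π_apply_Λ, π_apply_Λ, hT, hT]
  simp [mul_assoc]

variable [CompleteSpace E]

theorem T_nonneg (ρ : A →ₗ[ℂ] 𝓜(ℂ, B)) (hρ : ρ ∈ K.H) : 0 ≤ K.T ρ hρ :=
  AdjointableEnd.isPos_iff_nonneg.1 (K.T_spec ρ hρ).1

/-- The factor λ < 1 in 𝓖_φ keeps T_ρ uniformly below 1, so that 1 - T_ρ is invertible; directedness
relies on this. -/
theorem T_le_smul_one (ρ : K.G) : ∃ c : ℝ, 0 ≤ c ∧ c < 1 ∧
    K.T ρ.1 (K.G_subset_H ρ.2) ≤ (c : ℂ) • 1 := by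
  obtain ⟨c, hc0, hc1, σ, ⟨hσ, hpos⟩, hρσ⟩ := ρ.2
  refine ⟨c, hc0, hc1, ?_⟩
  have h : K.T ρ.1 (K.G_subset_H ρ.2) = (c : ℂ) • K.T σ hσ := by
    refine (K.T_spec ρ.1 _).2.unique ?_
    have := (K.T_spec σ hσ).2.smul c
    rwa [← hρσ] at this
  rw [h, Complex.coe_smul, Complex.coe_smul]
  exact smul_le_smul_of_nonneg_left (sub_nonneg.1 (AdjointableEnd.isPos_iff_nonneg.1 hpos)) hc0

theorem T_le_one (ρ : K.G) : K.T ρ.1 (K.G_subset_H ρ.2) ≤ 1 := by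
  obtain ⟨c, hc0, hc1, h⟩ := K.T_le_smul_one ρ
  refine h.trans ?_
  rw [Complex.coe_smul]
  nth_rw 2 [← one_smul ℝ (1 : AdjointableEnd B E)]
  exact smul_le_smul_of_nonneg_right hc1.le zero_le_one

theorem norm_one_sub_T_le (ρ : K.G) : ‖1 - K.T ρ.1 (K.G_subset_H ρ.2)‖ ≤ 1 :=
  (CStarAlgebra.norm_le_one_iff_of_nonneg _ (sub_nonneg.2 (K.T_le_one ρ))).2
    (sub_le_self 1 (K.T_nonneg _ _))

theorem norm_T_le (ρ : K.G) : ‖K.T ρ.1 (K.G_subset_H ρ.2)‖ ≤ 1 :=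
  (CStarAlgebra.norm_le_one_iff_of_nonneg _ (K.T_nonneg _ _)).2 (K.T_le_one ρ)

/-- For v = Λ(a)b, ‖(1 - T_ρ)v‖² ≤ ‖⟨(1 - T_ρ)v, v⟩‖ = ‖b*(φ(a*a) - ρ(a*a))b‖, which tends to 0. The
bound ‖T_ρ‖ ≤ 1 extends this to all v. -/
theorem tendsto_T (hlsc : K.IsLowerSemicontinuous) (v : E) :
    Tendsto (fun ρ : K.G => (K.T ρ.1 (K.G_subset_H ρ.2)).1 v) atTop (𝓝 v) := by
  refine ContinuousLinearMap.tendsto_of_dense_span (g := ContinuousLinearMap.id ℂ E) (C := 1)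
    (Eventually.of_forall fun ρ => K.norm_T_le ρ) K.dense' ?_ v
  rintro _ ⟨a, b, rfl⟩
  have h := hlsc.2 _ a.2
  rw [nhds_induced, tendsto_comap_iff] at h
  have h1 : Tendsto (fun ρ : K.G => (ρ.1 (star (a : A) * a)).fst b) atTop
      (𝓝 ((φ.form a a).fst b)) :=
    tendsto_pi_nhds.1 ((continuous_fst.tendsto _).comp h) b
  have h2 : Tendsto (fun ρ : K.G => ‖rinner B ((1 - K.T ρ.1 (K.G_subset_H ρ.2)).1 ((K.Λ a).1 b))
      ((K.Λ a).1 b)‖) atTop (𝓝 0) := by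
    have h3 : ∀ ρ : K.G, rinner B ((1 - K.T ρ.1 (K.G_subset_H ρ.2)).1 ((K.Λ a).1 b))
        ((K.Λ a).1 b) = star b * (φ.form a a).fst b - star b * (ρ.1 (star (a : A) * a)).fst b := by
      intro ρ
      rw [AdjointableEnd.sub_apply, rinner_sub_left, (K.T_spec _ _).2, AdjointableEnd.one_apply,
        K.inner']
    simp_rw [h3]
    simpa using ((h1.const_mul (star b)).const_sub (star b * (φ.form a a).fst b)).norm
  rw [tendsto_iff_norm_sub_tendsto_zero]
  have h4 : Tendsto (fun ρ : K.G => √‖rinner B ((1 - K.T ρ.1 (K.G_subset_H ρ.2)).1 ((K.Λ a).1 b))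
      ((K.Λ a).1 b)‖) atTop (𝓝 0) := by
    rw [← Real.sqrt_zero]
    exact (Real.continuous_sqrt.tendsto 0).comp h2
  refine squeeze_zero (fun _ => norm_nonneg _) (fun ρ => ?_) h4
  refine Real.le_sqrt_of_sq_le ?_
  rw [norm_sub_rev]
  refine (AdjointableEnd.norm_apply_sq_le (sub_nonneg.2 (K.T_le_one ρ)) _).trans ?_
  exact mul_le_of_le_one_left (norm_nonneg _) (K.norm_one_sub_T_le ρ)

end KSGNS

/-! ### Strict convergence of multipliers. -/

section Strict

theorem tendsto_strictTopology_iff {B : Type*} [NonUnitalCStarAlgebra B] {α : Type*} {l : Filter α}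
    {f : α → 𝓜(ℂ, B)} {m : 𝓜(ℂ, B)} :
    Tendsto f l (@nhds _ (strictTopology B) m) ↔
      (∀ b, Tendsto (fun i => (f i).fst b) l (𝓝 (m.fst b))) ∧
      ∀ b, Tendsto (fun i => (f i).snd b) l (𝓝 (m.snd b)) := by
  rw [nhds_induced, tendsto_comap_iff, Prod.tendsto_iff, tendsto_pi_nhds, tendsto_pi_nhds]
  rfl

theorem tendsto_strictTopologyOn_iff {A : Type*} [NonUnitalCStarAlgebra A] {α : Type*}
    {l : Filter α} {f : α → A} {a : A} :
    Tendsto f l (@nhds _ (strictTopologyOn A) a) ↔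
      (∀ c, Tendsto (fun i => f i * c) l (𝓝 (a * c))) ∧
      ∀ c, Tendsto (fun i => c * f i) l (𝓝 (c * a)) := by
  let _ := strictTopology A
  rw [nhds_induced, tendsto_comap_iff]
  exact tendsto_strictTopology_iff

/-- A function whose oscillation is controlled by that of a convergent one converges. -/
theorem exists_tendsto_of_norm_sub_le {α X Y : Type*} [NormedAddCommGroup X]
    [NormedAddCommGroup Y] [CompleteSpace Y] {l : Filter α} [l.NeBot] {f : α → Y} {g : α → X}
    {x : X} (hg : Tendsto g l (𝓝 x)) {C : ℝ} (h : ∀ i j, ‖f i - f j‖ ≤ C * ‖g i - g j‖) :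
    ∃ y, Tendsto f l (𝓝 y) := by
  refine cauchy_map_iff_exists_tendsto.1 (Metric.cauchy_iff.2 ⟨inferInstance, fun ε hε => ?_⟩)
  obtain ⟨s, hs, hs'⟩ := (Metric.cauchy_iff.1 hg.cauchy_map).2 (ε / (|C| + 1)) (by positivity)
  refine ⟨f '' (g ⁻¹' s), image_mem_map hs, ?_⟩
  rintro _ ⟨i, hi, rfl⟩ _ ⟨j, hj, rfl⟩
  have hij := hs' _ hi _ hj
  rw [dist_eq_norm] at hij ⊢
  calc ‖f i - f j‖ ≤ C * ‖g i - g j‖ := h i j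
    _ ≤ (|C| + 1) * ‖g i - g j‖ := by
      gcongr
      linarith [le_abs_self C]
    _ < (|C| + 1) * (ε / (|C| + 1)) := by gcongr
    _ = ε := by field_simp

variable {B : Type*} [NonUnitalCStarAlgebra B] [PartialOrder B] [StarOrderedRing B]

theorem DoubleCentralizer.snd_eq_of_symm {m : 𝓜(ℂ, B)}
    (h : ∀ b d, star d * m.fst b = star (m.fst d) * b) (b : B) :
    m.snd b = star (m.fst (star b)) := by
  rw [← star_inj]
  refine eq_of_star_mul_eq fun d => ?_
  rw [← star_inj, star_mul, star_mul, star_star, star_star, star_star, m.central, ← h, star_star]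

/-- Completeness of bounded sets of symmetric multipliers for the strict topology. -/
theorem exists_tendsto_strictTopology {α : Type*} {l : Filter α} [l.NeBot] {m : α → 𝓜(ℂ, B)}
    (hsymm : ∀ i b d, star d * (m i).fst b = star ((m i).fst d) * b) {C : ℝ}
    (hC : ∀ i b, ‖(m i).fst b‖ ≤ C * ‖b‖) (hm : ∀ b, ∃ y, Tendsto (fun i => (m i).fst b) l (𝓝 y)) :
    ∃ m₀, Tendsto m l (@nhds _ (strictTopology B) m₀) := by
  choose f hf using hm
  let F : B →L[ℂ] B := (linearMapOfTendsto f (fun i => ((m i).fst : B →ₗ[ℂ] B))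
    (tendsto_pi_nhds.2 hf)).mkContinuous C fun b =>
      le_of_tendsto (hf b).norm (Eventually.of_forall fun i => hC i b)
  have hF (b : B) : F b = f b := rfl
  have hFsymm (b d : B) : star d * F b = star (F d) * b := by
    rw [hF, hF]
    refine tendsto_nhds_unique ((hf b).const_mul (star d)) ?_
    simp_rw [hsymm]
    exact (hf d).star.mul_const b
  let G : B →L[ℂ] B := LinearMap.mkContinuous
    { toFun b := star (F (star b))
      map_add' x y := by simp
      map_smul' c x := by simp } C fun b => by
        change ‖star (F (star b))‖ ≤ C * ‖b‖
        rw [norm_star, ← norm_star b]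
        exact le_of_tendsto (hf (star b)).norm (Eventually.of_forall fun i => hC i (star b))
  have hG (b : B) : G b = star (F (star b)) := rfl
  refine ⟨⟨(F, G), fun x y => ?_⟩, tendsto_strictTopology_iff.2 ⟨hf, fun b => ?_⟩⟩
  · change G x * y = x * F y
    rw [hG, ← hFsymm, star_star]
  · simp_rw [DoubleCentralizer.snd_eq_of_symm (hsymm _)]
    exact (hf (star b)).star

end Strict

/-! ### Closedness and non-degeneracy when `atTop` on 𝓖_φ is proper. -/

namespace KSGNS

variable {A B E : Type*} [NonUnitalCStarAlgebra A] [PartialOrder A] [StarOrderedRing A]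
  [NonUnitalCStarAlgebra B] [PartialOrder B] [StarOrderedRing B] {φ : CStarWeight A B}
  [NormedAddCommGroup E] [NormedSpace ℂ E] [SMul Bᵐᵒᵖ E] [CStarModule Bᵐᵒᵖ E]
  (K : KSGNS φ E)

variable {K} in
theorem Implements.rinner_tendsto {T : AdjointableEnd B E} {ρ : A →ₗ[ℂ] 𝓜(ℂ, B)}
    (hT : K.Implements T ρ) (hρ : IsCP ρ) {l : Filter φ.N} [l.NeBot] {a : A} {t : B → E}
    (ha : ∀ c, Tendsto (fun x : φ.N => c * (x : A)) l (𝓝 (c * a)))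
    (ht : ∀ b, Tendsto (fun x => (K.Λ x).1 b) l (𝓝 (t b))) (x : φ.N) (b d : B) :
    rinner B (T.1 (t b)) ((K.Λ x).1 d) = star d * (ρ (star (x : A) * a)).fst b := by
  refine tendsto_nhds_unique
    (((T.1.continuous.tendsto _).comp (ht b)).rinner tendsto_const_nhds) ?_
  simp only [Function.comp_apply, hT _ _ _ _]
  exact ((hρ.continuous_star_mul b d).tendsto _).comp (ha _)

variable {K} in
theorem Implements.rinner_tendsto_tendsto {T : AdjointableEnd B E} {ρ : A →ₗ[ℂ] 𝓜(ℂ, B)}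
    (hT : K.Implements T ρ) (hρ : IsCP ρ) {l : Filter φ.N} [l.NeBot] {a : A} {t : B → E}
    (ha : ∀ c, Tendsto (fun x : φ.N => c * (x : A)) l (𝓝 (c * a)))
    (ht : ∀ b, Tendsto (fun x => (K.Λ x).1 b) l (𝓝 (t b))) (b d : B) :
    rinner B (T.1 (t b)) (t d) = star d * (ρ (star a * a)).fst b := by
  refine tendsto_nhds_unique
    ((tendsto_const_nhds (x := T.1 (t b))).rinner (ht d)) ?_
  simp only [hT.rinner_tendsto hρ ha ht]
  refine ((hρ.continuous_star_mul b d).tendsto _).comp ?_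
  have := (ha (star a)).star
  simpa using this

variable [CompleteSpace E]

variable {K} in
theorem Implements.norm_apply_Λ_sq_le {T : AdjointableEnd B E} {ρ : A →ₗ[ℂ] 𝓜(ℂ, B)}
    (hT : K.Implements T ρ) (hT0 : 0 ≤ T) (a : φ.N) (b : B) :
    ‖T.1 ((K.Λ a).1 b)‖ ^ 2 ≤ ‖T‖ * ‖star b * (ρ (star (a : A) * a)).fst b‖ := by
  rw [← hT]
  exact AdjointableEnd.norm_apply_sq_le hT0 _

variable {K} in
-- The difference is T Λ(ea - a)b by commutation, and its squared norm is controlled by b* ρ((ea -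
-- a)*(ea - a)) b, which is norm continuous in ea - a. Without T there is no such control over Λ.
theorem Implements.tendsto_π {T : AdjointableEnd B E} {ρ : A →ₗ[ℂ] 𝓜(ℂ, B)}
    (hT : K.Implements T ρ) (hT0 : 0 ≤ T) (hρ : IsCP ρ) (a : φ.N) (b : B) :
    Tendsto (fun e => (K.π e).1 (T.1 ((K.Λ a).1 b))) (CStarAlgebra.approximateUnit A)
      (𝓝 (T.1 ((K.Λ a).1 b))) := by
  have hl := CStarAlgebra.increasingApproximateUnit A
  have h1 : Tendsto (fun e : A => ‖T‖ *
      ‖star b * (ρ (star (e * a - a) * (e * a - a))).fst b‖) (CStarAlgebra.approximateUnit A)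
      (𝓝 0) := by
    have h2 : Tendsto (fun e : A => e * (a : A) - a) (CStarAlgebra.approximateUnit A) (𝓝 0) := by
      simpa using (hl.tendsto_mul_right (a : A)).sub_const (a : A)
    have h3 := ((hρ.continuous_star_mul b b).tendsto (star 0 * 0)).comp (h2.star.mul h2)
    simpa using h3.norm.const_mul ‖T‖
  rw [tendsto_iff_norm_sub_tendsto_zero]
  have h4 : Tendsto (fun e : A => √(‖T‖ *
      ‖star b * (ρ (star (e * a - a) * (e * a - a))).fst b‖)) (CStarAlgebra.approximateUnit A)
      (𝓝 0) := by
    rw [← Real.sqrt_zero]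
    exact (Real.continuous_sqrt.tendsto 0).comp h1
  refine squeeze_zero (fun _ => norm_nonneg _) (fun e => Real.le_sqrt_of_sq_le ?_) h4
  have h5 : (K.π e).1 (T.1 ((K.Λ a).1 b)) - T.1 ((K.Λ a).1 b)
      = T.1 ((K.Λ (⟨e * a, φ.cone.mul_mem_leftIdeal e a.2⟩ - a)).1 b) := by
    rw [← AdjointableEnd.mul_apply, ← hT.commute, AdjointableEnd.mul_apply, π_apply_Λ, ← map_sub,
      map_sub K.Λ]
    rfl
  rw [h5]
  exact hT.norm_apply_Λ_sq_le hT0 _ _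

theorem isNondegenerate_of_neBot (hlsc : K.IsLowerSemicontinuous)
    [(atTop : Filter K.G).NeBot] : K.IsNondegenerate := by
  set P := Submodule.span ℂ {w : E | ∃ (x : A) (v : E), w = (K.π x).1 v}
  have hl := CStarAlgebra.increasingApproximateUnit A
  have := hl.neBot
  have key (ρ : K.G) (v : E) : (K.T ρ.1 (K.G_subset_H ρ.2)).1 v ∈ closure (P : Set E) := by
    set T := K.T ρ.1 (K.G_subset_H ρ.2)
    have hle : Submodule.span ℂ {v : E | ∃ (a : φ.N) (b : B), v = (K.Λ a).1 b}
        ≤ P.topologicalClosure.comap (T.1 : E →ₗ[ℂ] E) := by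
      rw [Submodule.span_le]
      rintro _ ⟨a, b, rfl⟩
      refine mem_closure_of_tendsto ((K.T_spec _ (K.G_subset_H ρ.2)).2.tendsto_π (K.T_nonneg _ _)
        (K.G_subset_H ρ.2).2.1 a b) (Eventually.of_forall fun e => ?_)
      exact Submodule.subset_span ⟨e, _, rfl⟩
    have hcl : IsClosed (T.1 ⁻¹' closure (P : Set E)) := isClosed_closure.preimage T.1.continuous
    have := closure_minimal (s := (Submodule.span ℂ {v : E | ∃ (a : φ.N) (b : B),
      v = (K.Λ a).1 b} : Set E)) hle hcl
    exact this (K.dense' v)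
  intro v
  rw [← closure_closure]
  exact mem_closure_of_tendsto (K.tendsto_T hlsc v) (Eventually.of_forall fun ρ => key ρ v)

/-- A pointwise limit of `Λ` along a net which converges strictly is `Λ` of the limit. -/
theorem exists_Λ_eq_of_tendsto (hlsc : K.IsLowerSemicontinuous)
    [(atTop : Filter K.G).NeBot] {l : Filter φ.N} [l.NeBot] {a : A} {t : B →ₗ[ℂ] E}
    (ha : ∀ c, Tendsto (fun x : φ.N => c * (x : A)) l (𝓝 (c * a)))
    (ht : ∀ b, Tendsto (fun x => (K.Λ x).1 b) l (𝓝 (t b))) :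
    ∃ h : a ∈ φ.N, ∀ b, (K.Λ ⟨a, h⟩).1 b = t b := by
  let T (ρ : K.G) := K.T ρ.1 (K.G_subset_H ρ.2)
  have hT (ρ : K.G) : K.Implements (T ρ) ρ.1 := (K.T_spec _ _).2
  have hT0 (ρ : K.G) : 0 ≤ T ρ := K.T_nonneg _ _
  have hcp (ρ : K.G) : IsCP ρ.1 := (K.G_subset_H ρ.2).2.1
  let m (ρ : K.G) := ρ.1 (star a * a)
  have hm (ρ : K.G) (b d : B) : star d * (m ρ).fst b = rinner B ((T ρ).1 (t b)) (t d) :=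
    ((hT ρ).rinner_tendsto_tendsto (hcp ρ) ha ht b d).symm
  have htend (v : E) : Tendsto (fun ρ => (T ρ).1 v) atTop (𝓝 v) := K.tendsto_T hlsc v
  -- A pointwise limit along a filter need not be bounded. Each T_ρ t is bounded, by a constant
  -- depending on ρ, and ‖T_ρ t b‖ ≤ ‖t b‖; Banach–Steinhaus gives a uniform constant, which T_ρ → 1
  -- passes to t.
  obtain ⟨C, hC0, hC⟩ : ∃ C, 0 ≤ C ∧ ∀ b, ‖t b‖ ≤ C * ‖b‖ := by
    have hbd (ρ : K.G) (b : B) : ‖(T ρ).1 (t b)‖ ≤ √(‖T ρ‖ * ‖(m ρ).fst‖) * ‖b‖ := by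
      have hx : √(‖T ρ‖ * ‖(m ρ).fst‖) * ‖b‖ = √(‖T ρ‖ * ‖(m ρ).fst‖ * ‖b‖ ^ 2) := by
        rw [Real.sqrt_mul' _ (sq_nonneg _), Real.sqrt_sq (norm_nonneg b)]
      rw [hx]
      refine Real.le_sqrt_of_sq_le ((AdjointableEnd.norm_apply_sq_le (hT0 ρ) _).trans ?_)
      rw [← hm, mul_assoc]
      gcongr
      calc _ ≤ ‖star b‖ * (‖(m ρ).fst‖ * ‖b‖) :=
            (norm_mul_le _ _).trans (by gcongr; exact (m ρ).fst.le_opNorm b)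
        _ = _ := by rw [norm_star]; ring
    let g (ρ : K.G) : B →L[ℂ] E := (((T ρ).1 : E →ₗ[ℂ] E).comp t).mkContinuous _ (hbd ρ)
    have hg (ρ : K.G) (b : B) : g ρ b = (T ρ).1 (t b) := rfl
    obtain ⟨C, hC⟩ := banach_steinhaus (g := g) fun b => ⟨‖t b‖, fun ρ => by
      rw [hg]
      exact (AdjointableEnd.norm_apply_le _ _).trans
        (mul_le_of_le_one_left (norm_nonneg _) (K.norm_T_le ρ))⟩
    refine ⟨max C 0, le_max_right _ _, fun b => ?_⟩
    refine le_of_tendsto (htend (t b)).norm (Eventually.of_forall fun ρ => ?_)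
    rw [← hg]
    exact (g ρ).le_of_opNorm_le ((hC ρ).trans (le_max_left _ _)) b
  have hsymm (ρ : K.G) (b d : B) : star d * (m ρ).fst b = star ((m ρ).fst d) * b := by
    have h : star ((m ρ).fst d) * b = star (star b * (m ρ).fst d) := by simp
    rw [h, hm, hm, rinner_star, AdjointableEnd.rinner_apply_left,
      (IsSelfAdjoint.of_nonneg (hT0 ρ)).star_eq]
  have hmbd (ρ : K.G) (b : B) : ‖(m ρ).fst b‖ ≤ C * C * ‖b‖ := by
    refine norm_le_of_norm_star_mul_self_le (by positivity) ?_
    rw [hm]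
    refine (norm_rinner_le _ _).trans ?_
    calc _ ≤ (1 * (C * ‖b‖)) * (C * ‖(m ρ).fst b‖) := by
          gcongr
          · refine (AdjointableEnd.norm_apply_le _ _).trans ?_
            gcongr
            · exact K.norm_T_le ρ
            · exact hC b
          · exact hC _
      _ = _ := by ring
  -- Pairing the difference y of two values with itself gives ‖y‖² ≤ ‖(T_ρ - T_σ) t b‖ · C‖y‖, so
  -- the Cauchy property is inherited from T_ρ t b.
  have hlim (b : B) : ∃ y, Tendsto (fun ρ => (m ρ).fst b) atTop (𝓝 y) := by
    refine exists_tendsto_of_norm_sub_le (htend (t b)) (C := C) fun ρ σ => ?_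
    refine norm_le_of_norm_star_mul_self_le (by positivity) ?_
    set y := (m ρ).fst b - (m σ).fst b
    have hy : star y * y = rinner B ((T ρ).1 (t b) - (T σ).1 (t b)) (t y) := by
      rw [rinner_sub_left, ← hm, ← hm, ← mul_sub]
    rw [hy]
    refine (norm_rinner_le _ _).trans ?_
    calc _ ≤ ‖(T ρ).1 (t b) - (T σ).1 (t b)‖ * (C * ‖y‖) := by gcongr; exact hC y
      _ = _ := by ring
  have haN : a ∈ φ.N :=
    (hlsc.1 _ (star_mul_self_nonneg a)).2 (exists_tendsto_strictTopology hsymm hmbd hlim)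
  refine ⟨haN, fun b => ?_⟩
  refine tendsto_nhds_unique (htend _) ?_
  -- Both T_ρ Λ(a)b and T_ρ t b pair with Λ(x)d to d* ρ(x*a) b, so the two nets coincide.
  convert htend (t b) using 2 with ρ
  refine K.eq_of_rinner_Λ fun x d => ?_
  rw [(hT ρ).rinner_tendsto (hcp ρ) ha ht, hT ρ]

theorem lambdaIsClosed_of_neBot (hlsc : K.IsLowerSemicontinuous)
    [(atTop : Filter K.G).NeBot] : K.LambdaIsClosed := by
  refine (@isClosed_iff_ultrafilter _ _ (@instTopologicalSpaceProd _ _ (strictTopologyOn A)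
    (strongTopology B E))).2 ?_
  rintro ⟨a, t⟩ u hu hmem
  rw [@nhds_prod_eq _ _ (strictTopologyOn A) (strongTopology B E)] at hu
  let g (x : φ.N) : A × (B →ₗ[ℂ] E) := ((x : A), ((K.Λ x).1 : B →ₗ[ℂ] E))
  have hrange : Set.range g ∈ (u : Filter _) := by
    refine mem_of_superset hmem ?_
    rintro _ ⟨x, rfl⟩
    exact ⟨x, rfl⟩
  have : (comap g u).NeBot := u.neBot.comap_of_range_mem hrange
  have hg : Tendsto g (comap g u)
      (@nhds A (strictTopologyOn A) a ×ˢ @nhds _ (strongTopology B E) t) :=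
    tendsto_comap.mono_right hu
  have ha := (tendsto_strictTopologyOn_iff.1 (tendsto_fst.comp hg)).2
  have ht := tendsto_snd.comp hg
  rw [nhds_induced, tendsto_comap_iff, tendsto_pi_nhds] at ht
  obtain ⟨h, hb⟩ := K.exists_Λ_eq_of_tendsto hlsc ha ht
  exact ⟨⟨a, h⟩, Prod.ext rfl (LinearMap.ext fun b => (hb b).symm)⟩

end KSGNS

/-- A bounded family of operators into a complete space which converges pointwise on a set spanning
a dense subspace has a strong limit. -/
theorem ContinuousLinearMap.exists_tendsto_of_dense_span {ι E F : Type*} [NormedAddCommGroup E]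
    [NormedSpace ℂ E] [NormedAddCommGroup F] [NormedSpace ℂ F] [CompleteSpace F] {l : Filter ι}
    [l.NeBot] {f : ι → E →L[ℂ] F} {C : ℝ} (hC : ∀ᶠ i in l, ‖f i‖ ≤ C) {s : Set E}
    (hs : Dense (Submodule.span ℂ s : Set E))
    (h : ∀ v ∈ s, ∃ y, Tendsto (fun i => f i v) l (𝓝 y)) :
    ∃ g : E →L[ℂ] F, ∀ v, Tendsto (fun i => f i v) l (𝓝 (g v)) := by
  have hlim (v : E) : ∃ y, Tendsto (fun i => f i v) l (𝓝 y) := by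
    refine cauchy_map_iff_exists_tendsto.1 (cauchy_map_iff.2 ⟨inferInstance, ?_⟩)
    rw [uniformity_eq_comap_nhds_zero, tendsto_comap_iff]
    have hC2 : ∀ᶠ p : ι × ι in l ×ˢ l, ‖f p.2 - f p.1‖ ≤ C + C := by
      filter_upwards [hC.prod_mk hC] with p hp
      exact (norm_sub_le _ _).trans (add_le_add hp.2 hp.1)
    refine ContinuousLinearMap.tendsto_of_dense_span (g := 0) hC2 hs (fun w hw => ?_) v
    obtain ⟨y, hy⟩ := h w hw
    simpa using (hy.comp tendsto_snd).sub (hy.comp tendsto_fst)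
  choose g hg using hlim
  exact ⟨(linearMapOfTendsto g (fun i => (f i : E →ₗ[ℂ] F)) (tendsto_pi_nhds.2 hg)).mkContinuous C
    fun v => le_of_tendsto (hg v).norm (hC.mono fun i hi => (f i).le_of_opNorm_le hi v), hg⟩

/-! ### Everywhere defined weights: bounded Λ, and maps built from the commutant. -/

namespace KSGNS

variable {A B E : Type*} [NonUnitalCStarAlgebra A] [PartialOrder A] [StarOrderedRing A]
  [NonUnitalCStarAlgebra B] [PartialOrder B] [StarOrderedRing B] {φ : CStarWeight A B}
  [NormedAddCommGroup E] [NormedSpace ℂ E] [SMul Bᵐᵒᵖ E] [CStarModule Bᵐᵒᵖ E]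
  (K : KSGNS φ E)

/-- If `φ` is everywhere defined, then `Λ` is a bounded operator. -/
theorem exists_clm_Λ (hN : ∀ a : A, a ∈ φ.N) :
    ∃ L : A →L[ℂ] B →L[ℂ] E, ∀ a, L a = (K.Λ ⟨a, hN a⟩).1 := by
  have hdom (x : A) : x ∈ φ.dom := by
    have h : Submodule.span ℂ {x : A | 0 ≤ x} ≤ φ.dom := by
      rw [Submodule.span_le]
      intro x hx
      obtain ⟨a, rfl⟩ := CStarAlgebra.nonneg_iff_eq_star_mul_self.1 hx
      exact Submodule.subset_span (hN a)
    rw [CStarAlgebra.span_nonneg] at h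
    exact h trivial
  let f : A →ₗ[ℂ] 𝓜(ℂ, B) := φ.toLin.comp (LinearMap.id.codRestrict φ.dom hdom)
  have hf (a : A) (b : B) : 0 ≤ star b * (f (star a * a)).fst b := by
    simpa using! φ.positive' 1 (fun _ => ⟨a, hN a⟩) (fun _ => b)
  let Λ' : A →ₗ[ℂ] B →L[ℂ] E :=
    { toFun a := (K.Λ ⟨a, hN a⟩).1
      map_add' x y := congrArg Subtype.val (K.Λ.map_add ⟨x, hN x⟩ ⟨y, hN y⟩)
      map_smul' c x := congrArg Subtype.val (K.Λ.map_smul c ⟨x, hN x⟩) }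
  have hsq (a : A) (b : B) : ‖Λ' a b‖ ^ 2 = ‖star b * (f (star a * a)).fst b‖ := by
    rw [← norm_rinner_self (B := B)]
    exact congrArg _ (K.inner' ⟨a, hN a⟩ ⟨a, hN a⟩ b b)
  have hcont (b : B) : Continuous fun a => Λ' a b := by
    let g : A →ₗ[ℂ] E := (ContinuousLinearMap.apply ℂ E b : (B →L[ℂ] E) →ₗ[ℂ] E).comp Λ'
    refine continuous_of_continuousAt_zero g ?_
    have h1 : Continuous fun a : A => √‖star b * (f (star a * a)).fst b‖ :=
      ((continuous_star_mul_of_nonneg f hf b b).comp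
        (continuous_star.mul continuous_id)).norm.sqrt
    have h2 : Tendsto (fun a => ‖Λ' a b‖) (𝓝 0) (𝓝 0) := by
      have h3 := h1.tendsto 0
      simp_rw [← hsq, Real.sqrt_sq (norm_nonneg _)] at h3
      simpa using h3
    rw [ContinuousAt, map_zero, tendsto_zero_iff_norm_tendsto_zero]
    exact h2
  -- Λ(·)b is bounded for each b, so the normalized operators are pointwise bounded. At a = 0 the
  -- convention 0⁻¹ = 0 gives the zero operator.
  obtain ⟨C, hC⟩ := banach_steinhaus (g := fun a : A => ((‖a‖⁻¹ : ℝ) : ℂ) • Λ' a) fun b => by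
    let g : A →L[ℂ] E := ⟨(ContinuousLinearMap.apply ℂ E b : (B →L[ℂ] E) →ₗ[ℂ] E).comp Λ', hcont b⟩
    refine ⟨‖g‖, fun a => ?_⟩
    change ‖((‖a‖⁻¹ : ℝ) : ℂ) • g a‖ ≤ ‖g‖
    rw [norm_smul, Complex.norm_real, norm_inv, norm_norm, mul_comm, ← div_eq_mul_inv]
    exact g.ratio_le_opNorm a
  refine ⟨Λ'.mkContinuous C fun a => ?_, fun a => rfl⟩
  rcases eq_or_ne a 0 with rfl | ha
  · simp
  · have := hC a
    rw [norm_smul, Complex.norm_real, norm_inv, norm_norm, inv_mul_le_iff₀ (norm_pos_iff.2 ha)]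
      at this
    rwa [mul_comm]

variable [CompleteSpace E] {K} {hN : ∀ a : A, a ∈ φ.N} {L : A →L[ℂ] B →L[ℂ] E}
  (hL : ∀ a, L a = (K.Λ ⟨a, hN a⟩).1)
include hL

theorem π_apply_clm (x a : A) (b : B) : (K.π x).1 (L a b) = L (x * a) b := by
  rw [hL, hL, π_apply_Λ]

theorem tendsto_clm_mul_right (x : A) (b : B) :
    Tendsto (fun e => L (e * x) b) (CStarAlgebra.approximateUnit A) (𝓝 (L x b)) := by
  have hl := CStarAlgebra.increasingApproximateUnit A
  exact (((ContinuousLinearMap.apply ℂ E b).comp L).continuous.tendsto _).comp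
    (hl.tendsto_mul_right x)

theorem isNondegenerate_of_clm : K.IsNondegenerate := by
  have hl := CStarAlgebra.increasingApproximateUnit A
  have := hl.neBot
  set P := Submodule.span ℂ {w : E | ∃ (x : A) (v : E), w = (K.π x).1 v}
  have hle : Submodule.span ℂ {v : E | ∃ (a : φ.N) (b : B), v = (K.Λ a).1 b}
      ≤ P.topologicalClosure := by
    rw [Submodule.span_le]
    rintro _ ⟨a, b, rfl⟩
    rw [← hL]
    refine mem_closure_of_tendsto (tendsto_clm_mul_right hL _ b) (Eventually.of_forall fun e => ?_)
    rw [← π_apply_clm hL]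
    exact Submodule.subset_span ⟨e, _, rfl⟩
  intro v
  have := closure_mono (show _ ⊆ closure (P : Set E) from hle) (K.dense' v)
  rwa [closure_closure] at this

/-- The operator `E → B` which is formally the adjoint of `Λ(1)`. -/
theorem exists_adjoint_one : ∃ V : E →L[ℂ] B, ∀ (c : A) (w : E) (d : B),
    star d * V ((K.π c).1 w) = rinner B w (L (star c) d) := by
  have hl := CStarAlgebra.increasingApproximateUnit A
  have := hl.neBot
  have hadj (a : A) : ∃ S : E →L[ℂ] B, ∀ b w, rinner B (L a b) w = rinner B b (S w) := by
    rw [hL]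
    exact (K.Λ ⟨a, hN a⟩).2
  choose S hS using hadj
  have hS' (a : A) (w : E) (d : B) : star d * S a w = rinner B w (L a d) := by
    rw [← rinner_star, hS, rinner_star]
    rfl
  have hSle (a : A) (w : E) : ‖S a w‖ ≤ ‖L‖ * ‖a‖ * ‖w‖ := by
    refine norm_le_of_norm_star_mul_self_le (by positivity) ?_
    rw [hS']
    calc _ ≤ ‖w‖ * (‖L‖ * ‖a‖ * ‖S a w‖) :=
          (norm_rinner_le _ _).trans (by gcongr; exact L.le_opNorm₂ _ _)
      _ = _ := by ring
  have hSsub (a a' : A) (w : E) : S a w - S a' w = S (a - a') w := by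
    refine eq_of_star_mul_eq fun d => ?_
    rw [mul_sub, hS', hS', hS', map_sub, sub_apply, rinner_sub_right]
  have hSπ (a c : A) (w : E) : S a ((K.π c).1 w) = S (star c * a) w := by
    refine eq_of_star_mul_eq fun d => ?_
    rw [hS', hS', rinner_π_left, π_apply_clm hL]
  -- Λ(e)*π(c) = Λ(c*e)* tends to Λ(c*)*, so the bounded operators Λ(e)* converge on π(A)E, which
  -- spans a dense subspace.
  have hlim (c : A) (w : E) : Tendsto (fun e => S e ((K.π c).1 w))
      (CStarAlgebra.approximateUnit A) (𝓝 (S (star c) w)) := by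
    simp_rw [hSπ]
    rw [tendsto_iff_norm_sub_tendsto_zero]
    have h := ((tendsto_iff_norm_sub_tendsto_zero.1 (hl.tendsto_mul_left (star c))).const_mul
      ‖L‖).mul_const ‖w‖
    rw [mul_zero, zero_mul] at h
    refine squeeze_zero (fun _ => norm_nonneg _) (fun e => ?_) h
    rw [hSsub]
    exact hSle _ _
  obtain ⟨V, hV⟩ := ContinuousLinearMap.exists_tendsto_of_dense_span (f := S) (C := ‖L‖)
    (l := CStarAlgebra.approximateUnit A)
    (hl.eventually_norm.mono fun e he => (S e).opNorm_le_bound L.opNorm_nonneg fun w =>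
      (hSle e w).trans (by
        gcongr
        exact mul_le_of_le_one_right L.opNorm_nonneg he))
    (isNondegenerate_of_clm hL) (by
      rintro _ ⟨c, w, rfl⟩
      exact ⟨_, hlim c w⟩)
  refine ⟨V, fun c w d => ?_⟩
  rw [tendsto_nhds_unique (hV _) (hlim c w), hS']

/-- An operator `S` in the commutant of `π(A)` defines a map `V S Λ(·)` from `A` to `M(B)`. -/
theorem exists_map_of_commute {V : E →L[ℂ] B} (hV : ∀ (c : A) (w : E) (d : B),
      star d * V ((K.π c).1 w) = rinner B w (L (star c) d)) {S : AdjointableEnd B E}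
    (hS : ∀ x, Commute S (K.π x)) : ∃ ω : A →ₗ[ℂ] 𝓜(ℂ, B), K.Implements S ω ∧
      (∀ x b, (ω x).fst b = V (S.1 (L x b))) ∧
      ∀ x b, (ω x).snd b = star (V ((star S).1 (L (star x) (star b)))) := by
  have hl := CStarAlgebra.increasingApproximateUnit A
  have := hl.neBot
  have hS' : ∀ x, Commute (star S) (K.π x) := fun x => by
    have := (hS (star x)).star_star
    rwa [map_star, star_star] at this
  have key {R : AdjointableEnd B E} (hR : ∀ x, Commute R (K.π x)) (c a : A) (b d : B) :
      star d * V (R.1 (L (c * a) b)) = rinner B (R.1 (L a b)) (L (star c) d) := by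
    rw [← π_apply_clm hL, ← AdjointableEnd.mul_apply, (hR c).eq, AdjointableEnd.mul_apply, hV]
  have hcont (R : AdjointableEnd B E) (b : B) : Continuous fun x => V (R.1 (L x b)) :=
    (V.comp (R.1.comp ((ContinuousLinearMap.apply ℂ E b).comp L))).continuous
  have hsymm (x : A) (b d : B) :
      star (V ((star S).1 (L (star x) d))) * b = star d * V (S.1 (L x b)) := by
    have hc1 : Continuous fun x => star (V ((star S).1 (L (star x) d))) * b :=
      ((hcont (star S) d).comp continuous_star).star.mul continuous_const
    have hc2 : Continuous fun x => star d * V (S.1 (L x b)) := continuous_const.mul (hcont S b)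
    -- `key` evaluates V only on factored elements, so the identity is checked at ex and passed to
    -- the limit.
    refine tendsto_nhds_unique ((hc1.tendsto x).comp (hl.tendsto_mul_right x)) ?_
    have h2 := (hc2.tendsto x).comp (hl.tendsto_mul_right x)
    refine h2.congr fun e => ?_
    have h3 : star (V ((star S).1 (L (star (e * x)) d))) * b
        = star (star b * V ((star S).1 (L (star x * star e) d))) := by
      simp
    simp only [Function.comp_apply]
    rw [h3, key hS, key hS', star_star, rinner_star, AdjointableEnd.rinner_apply_left]
  let fst (x : A) : B →L[ℂ] B := V.comp (S.1.comp (L x))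
  let snd (x : A) : B →L[ℂ] B := LinearMap.mkContinuous
    { toFun b := star (V ((star S).1 (L (star x) (star b))))
      map_add' x y := by simp
      map_smul' c x := by simp } (‖V.comp ((star S).1.comp (L (star x)))‖) fun b => by
        rw [← norm_star b]
        simpa using (V.comp ((star S).1.comp (L (star x)))).le_opNorm (star b)
  let ω (x : A) : 𝓜(ℂ, B) := ⟨(fst x, snd x), fun c b => by
    have := hsymm x b (star c)
    rwa [star_star] at this⟩
  have hfst (x : A) (b : B) : (ω x).fst b = V (S.1 (L x b)) := rfl
  have hsnd (x : A) (b : B) : (ω x).snd b = star (V ((star S).1 (L (star x) (star b)))) := rfl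
  refine ⟨{ toFun := ω, map_add' := fun x y => ?_, map_smul' := fun c x => ?_ },
    fun a₁ a₂ b₁ b₂ => ?_, hfst, hsnd⟩
  · refine DoubleCentralizer.ext _ _ _ _ (Prod.ext ?_ ?_) <;> ext b
    · change (ω (x + y)).fst b = (ω x).fst b + (ω y).fst b
      simp [hfst]
    · change (ω (x + y)).snd b = (ω x).snd b + (ω y).snd b
      simp [hsnd]
  · refine DoubleCentralizer.ext _ _ _ _ (Prod.ext ?_ ?_) <;> ext b
    · change (ω (c • x)).fst b = c • (ω x).fst b
      simp [hfst]
    · change (ω (c • x)).snd b = c • (ω x).snd b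
      simp [hsnd]
  · change _ = star b₂ * (ω (star (a₂ : A) * a₁)).fst b₁
    rw [hfst, key hS, star_star, hL, hL]

end KSGNS

/-! ### Strictness of ρ in terms of T_ρ. -/

namespace KSGNS

variable {A B E : Type*} [NonUnitalCStarAlgebra A] [PartialOrder A] [StarOrderedRing A]
  [NonUnitalCStarAlgebra B] [PartialOrder B] [StarOrderedRing B] {φ : CStarWeight A B}
  [NormedAddCommGroup E] [NormedSpace ℂ E] [SMul Bᵐᵒᵖ E] [CStarModule Bᵐᵒᵖ E]

/-- `S` lies in the commutant of `π(A)` and `S Λ(·) b` has the form `π(·) v` for all `b`. -/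
def HasVectors (K : KSGNS φ E) (L : A →L[ℂ] B →L[ℂ] E) (S : AdjointableEnd B E) : Prop :=
  (∀ x, Commute S (K.π x)) ∧ ∀ b, ∃ v, ∀ y, S.1 (L y b) = (K.π y).1 v

variable {K : KSGNS φ E} {L : A →L[ℂ] B →L[ℂ] E}

theorem HasVectors.zero : K.HasVectors L 0 :=
  ⟨fun _ => Commute.zero_left _, fun _ => ⟨0, fun y => ((K.π y).1.map_zero).symm⟩⟩

theorem HasVectors.add {S T : AdjointableEnd B E} (hS : K.HasVectors L S)
    (hT : K.HasVectors L T) : K.HasVectors L (S + T) := by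
  refine ⟨fun x => (hS.1 x).add_left (hT.1 x), fun b => ?_⟩
  obtain ⟨v, hv⟩ := hS.2 b
  obtain ⟨w, hw⟩ := hT.2 b
  refine ⟨v + w, fun y => ?_⟩
  rw [AdjointableEnd.add_apply, hv, hw, map_add]

theorem HasVectors.mul_left {R S : AdjointableEnd B E} (hR : ∀ x, Commute R (K.π x))
    (hS : K.HasVectors L S) : K.HasVectors L (R * S) := by
  refine ⟨fun x => (hR x).mul_left (hS.1 x), fun b => ?_⟩
  obtain ⟨v, hv⟩ := hS.2 b
  refine ⟨R.1 v, fun y => ?_⟩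
  rw [AdjointableEnd.mul_apply, hv, ← AdjointableEnd.mul_apply, (hR y).eq,
    AdjointableEnd.mul_apply]

theorem HasVectors.smul {S : AdjointableEnd B E} (hS : K.HasVectors L S) (c : ℂ) :
    K.HasVectors L (c • S) := by
  refine ⟨fun x => (hS.1 x).smul_left c, fun b => ?_⟩
  obtain ⟨v, hv⟩ := hS.2 b
  refine ⟨c • v, fun y => ?_⟩
  rw [AdjointableEnd.smul_apply, hv, map_smul]

variable [CompleteSpace E]

theorem norm_π_le (x : A) : ‖(K.π x).1‖ ≤ ‖x‖ :=
  NonUnitalStarAlgHom.norm_apply_le K.π x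

/-- `π` is strictly-strongly continuous on bounded sets. -/
theorem tendsto_π_of_bounded (hnd : K.IsNondegenerate) {α : Type*} {l : Filter α} {f : α → A}
    {a : A} {C : ℝ} (hC : ∀ᶠ i in l, ‖f i‖ ≤ C)
    (hf : ∀ c, Tendsto (fun i => f i * c) l (𝓝 (a * c))) (v : E) :
    Tendsto (fun i => (K.π (f i)).1 v) l (𝓝 ((K.π a).1 v)) := by
  refine ContinuousLinearMap.tendsto_of_dense_span (hC.mono fun i hi => (norm_π_le _).trans hi)
    hnd ?_ v
  rintro _ ⟨c, w, rfl⟩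
  have hcont : Continuous fun x => (K.π x).1 w := by
    let g : A →ₗ[ℂ] E :=
      { toFun x := (K.π x).1 w
        map_add' x y := by rw [map_add]; rfl
        map_smul' c x := by rw [map_smul]; rfl }
    exact (g.mkContinuous ‖w‖ fun x => ((K.π x).1.le_of_opNorm_le (norm_π_le x) w).trans_eq
      (mul_comm _ _)).continuous
  have h := (hcont.tendsto _).comp (hf c)
  simpa [Function.comp_def] using h

/-- Replacing S Λ(x)b by π(x)v reduces strictness of V S Λ(·) to that of the non-degenerate π, which
is automatic on bounded sets. -/
theorem isStrict_of_hasVectors (hnd : K.IsNondegenerate) {V : E →L[ℂ] B} {S : AdjointableEnd B E}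
    (hS : K.HasVectors L S) (hsa : star S = S) {ω : A →ₗ[ℂ] 𝓜(ℂ, B)}
    (hfst : ∀ x b, (ω x).fst b = V (S.1 (L x b)))
    (hsnd : ∀ x b, (ω x).snd b = star (V ((star S).1 (L (star x) (star b))))) : IsStrict ω := by
  intro s hs a _
  obtain ⟨C, hC⟩ := hs.exists_norm_le
  have hid : Tendsto id (@nhdsWithin A (strictTopologyOn A) a s)
      (@nhds A (strictTopologyOn A) a) := @nhdsWithin_le_nhds A (strictTopologyOn A) a s
  obtain ⟨hr, hl⟩ := tendsto_strictTopologyOn_iff.1 hid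
  have hb : ∀ᶠ x in @nhdsWithin A (strictTopologyOn A) a s, ‖x‖ ≤ C :=
    mem_of_superset (@self_mem_nhdsWithin A (strictTopologyOn A) a s) fun x hx => hC x hx
  refine tendsto_strictTopology_iff.2 ⟨fun b => ?_, fun b => ?_⟩
  · obtain ⟨v, hv⟩ := hS.2 b
    simp_rw [hfst, hv]
    exact (V.continuous.tendsto _).comp (tendsto_π_of_bounded hnd hb hr v)
  · obtain ⟨v, hv⟩ := hS.2 (star b)
    simp_rw [hsnd, hsa, hv]
    refine ((V.continuous.tendsto _).comp (tendsto_π_of_bounded hnd (f := fun x => star x)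
      (C := C) (by simpa using hb) (fun c => ?_) v)).star
    simpa using (hl (star c)).star

variable {hN : ∀ a : A, a ∈ φ.N} (hL : ∀ a, L a = (K.Λ ⟨a, hN a⟩).1)
include hN

theorem Implements.isCP {T : AdjointableEnd B E} {ρ : A →ₗ[ℂ] 𝓜(ℂ, B)}
    (hT : K.Implements T ρ) (hT0 : 0 ≤ T) : IsCP ρ := by
  intro n a b
  have h := AdjointableEnd.rinner_nonneg hT0 (∑ i, (K.Λ ⟨a i, hN (a i)⟩).1 (b i))
  rw [map_sum, rinner_sum_left] at h
  simp_rw [rinner_sum_right, hT _ _ _ _] at h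
  exact h

include hL

/-- Positive strict contractions `T` with vectors implement elements of `𝓖_φ`. -/
theorem exists_mem_G {T : AdjointableEnd B E} (hT : K.HasVectors L T) (hT0 : 0 ≤ T) {c : ℝ}
    (hc0 : 0 < c) (hc1 : c < 1) (hTc : T ≤ (c : ℂ) • 1) : ∃ ρ ∈ K.G, K.Implements T ρ := by
  have hnd := isNondegenerate_of_clm hL
  obtain ⟨V, hV⟩ := exists_adjoint_one hL
  -- c⁻¹T is still at most 1, so it yields an element of 𝓕_φ, and multiplying back by c lands in
  -- 𝓖_φ.
  have hT' := hT.smul (c : ℂ)⁻¹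
  have hc : (c : ℂ) ≠ 0 := by exact_mod_cast hc0.ne'
  have hT0' : 0 ≤ (c : ℂ)⁻¹ • T := by
    rw [← Complex.ofReal_inv, Complex.coe_smul]
    exact smul_nonneg (inv_nonneg.2 hc0.le) hT0
  have hT1' : (c : ℂ)⁻¹ • T ≤ 1 := by
    have h := smul_le_smul_of_nonneg_left hTc (inv_nonneg.2 hc0.le)
    rw [← Complex.coe_smul, ← Complex.coe_smul, Complex.ofReal_inv, smul_smul,
      inv_mul_cancel₀ hc, one_smul] at h
    exact h
  obtain ⟨ω, hω, hfst, hsnd⟩ := exists_map_of_commute hL hV hT'.1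
  have hH : ω ∈ K.H := ⟨isStrict_of_hasVectors hnd hT' (IsSelfAdjoint.of_nonneg hT0').star_eq
    hfst hsnd, hω.isCP (hN := hN) hT0', _, AdjointableEnd.isPos_iff_nonneg.2 hT0', hω⟩
  refine ⟨(c : ℂ) • ω, ⟨c, hc0.le, hc1, ω, ⟨hH, ?_⟩, rfl⟩, ?_⟩
  · rw [(K.T_spec ω hH).2.unique hω, AdjointableEnd.isPos_iff_nonneg, sub_nonneg]
    exact hT1'
  · have h := hω.smul (c : ℂ)
    rwa [smul_smul, mul_inv_cancel₀ hc, one_smul] at h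

/-- The vector is v = lim T Λ(e)b, formally T Λ(1)b. The limit exists since (e - e')*(e - e') → 0
strictly and boundedly and ρ is strict; then π(y)v = lim T Λ(ye)b = T Λ(y)b. -/
theorem hasVectors_T (ρ : A →ₗ[ℂ] 𝓜(ℂ, B)) (hρ : ρ ∈ K.H) : K.HasVectors L (K.T ρ hρ) := by
  have hl := CStarAlgebra.increasingApproximateUnit A
  have := hl.neBot
  set l := CStarAlgebra.approximateUnit A
  set T := K.T ρ hρ
  have hT := (K.T_spec ρ hρ).2
  have hT0 := K.T_nonneg ρ hρ
  refine ⟨fun x => hT.commute x, fun b => ?_⟩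
  have hsub {x : A} : Tendsto (fun p : A × A => (p.1 - p.2) * x) (l ×ˢ l) (𝓝 0) := by
    simpa [sub_mul] using ((hl.tendsto_mul_right x).comp (tendsto_fst (g := l))).sub
      ((hl.tendsto_mul_right x).comp (tendsto_snd (f := l)))
  have hbd : ∀ᶠ p : A × A in l ×ˢ l, ‖p.1 - p.2‖ ≤ 2 := by
    filter_upwards [hl.eventually_norm.prod_mk hl.eventually_norm] with p hp
    exact (norm_sub_le _ _).trans (by linarith [hp.1, hp.2])
  have hsq (x : A) : Tendsto (fun p : A × A => star (p.1 - p.2) * (p.1 - p.2) * x) (l ×ˢ l)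
      (𝓝 0) := by
    have h := (tendsto_zero_iff_norm_tendsto_zero.1 (hsub (x := x))).const_mul 2
    rw [mul_zero] at h
    refine squeeze_zero_norm' ?_ h
    filter_upwards [hbd] with p hp
    rw [mul_assoc]
    refine (norm_mul_le _ _).trans ?_
    rw [norm_star]
    gcongr
  have hstrict : Tendsto (fun p : A × A => star (p.1 - p.2) * (p.1 - p.2)) (l ×ˢ l)
      (@nhds A (strictTopologyOn A) 0) := by
    refine tendsto_strictTopologyOn_iff.2 ⟨fun x => by simpa using hsq x, fun x => ?_⟩
    simpa [mul_assoc] using (hsq (star x)).star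
  have hmem : ∀ᶠ p : A × A in l ×ˢ l, star (p.1 - p.2) * (p.1 - p.2) ∈ Metric.closedBall 0 4 := by
    filter_upwards [hbd] with p hp
    rw [mem_closedBall_zero_iff, CStarRing.norm_star_mul_self]
    nlinarith [norm_nonneg (p.1 - p.2)]
  have hρ0 := (hρ.1 (Metric.closedBall 0 4) Metric.isBounded_closedBall 0
    (Metric.mem_closedBall_self (by norm_num)))
  have hρ1 := Tendsto.comp hρ0 (tendsto_inf.2 ⟨hstrict, tendsto_principal.2 hmem⟩)
  have hρ2 := (tendsto_strictTopology_iff.1 hρ1).1 b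
  have hcauchy : Tendsto (fun p : A × A => T.1 (L (p.1 - p.2) b)) (l ×ˢ l) (𝓝 0) := by
    have h1 : Tendsto (fun p : A × A => √(‖T‖ * ‖star b *
        (ρ (star (p.1 - p.2) * (p.1 - p.2))).fst b‖)) (l ×ˢ l) (𝓝 0) := by
      rw [← Real.sqrt_zero]
      refine (Real.continuous_sqrt.tendsto 0).comp ?_
      simpa using (hρ2.const_mul (star b)).norm.const_mul ‖T‖
    refine squeeze_zero_norm (fun p => Real.le_sqrt_of_sq_le ?_) h1
    rw [hL]
    exact hT.norm_apply_Λ_sq_le hT0 ⟨_, hN _⟩ b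
  obtain ⟨v, hv⟩ : ∃ v, Tendsto (fun e => T.1 (L e b)) l (𝓝 v) := by
    refine cauchy_map_iff_exists_tendsto.1 (cauchy_map_iff.2 ⟨inferInstance, ?_⟩)
    rw [uniformity_eq_comap_nhds_zero_swapped, tendsto_comap_iff]
    refine hcauchy.congr fun p => ?_
    simp
  refine ⟨v, fun y => ?_⟩
  refine tendsto_nhds_unique ?_ (((K.π y).1.continuous.tendsto v).comp hv)
  have h2 := ((T.1.comp ((ContinuousLinearMap.apply ℂ E b).comp L)).continuous.tendsto y).comp
    (hl.tendsto_mul_left y)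
  refine h2.congr fun e => ?_
  change T.1 (L (y * e) b) = (K.π y).1 (T.1 (L e b))
  rw [← π_apply_clm hL, ← AdjointableEnd.mul_apply, (hT.commute y), AdjointableEnd.mul_apply]

end KSGNS

/-! ### Order and inverses in unital C*-algebras. -/

section Order

variable {R : Type*} [CStarAlgebra R] [PartialOrder R] [StarOrderedRing R]

/-- For a positive strict contraction `a`, the element `1 - a` is invertible and its inverse is
at least `1`. -/
theorem exists_units_eq_one_sub {a : R} (ha : 0 ≤ a) {c : ℝ} (hc : c < 1)
    (hac : a ≤ (c : ℂ) • 1) : ∃ u : Rˣ, (u : R) = 1 - a ∧ 0 ≤ (u : R) ∧ 1 ≤ (↑u⁻¹ : R) := by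
  have h1 : ((1 - c : ℝ) : ℂ) • (1 : R) ≤ 1 - a := by
    rw [Complex.ofReal_sub, sub_smul, Complex.ofReal_one, one_smul]
    exact sub_le_sub_left hac 1
  have h2 : IsUnit (((1 - c : ℝ) : ℂ) • (1 : R)) := by
    have : ((1 - c : ℝ) : ℂ) ≠ 0 := by exact_mod_cast (sub_pos.2 hc).ne'
    exact (isUnit_one).smul (Units.mk0 _ this)
  have h3 : 0 ≤ ((1 - c : ℝ) : ℂ) • (1 : R) := by
    rw [Complex.coe_smul]
    exact smul_nonneg (sub_pos.2 hc).le zero_le_one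
  obtain ⟨u, hu⟩ := CStarAlgebra.isUnit_of_le _ h1 ⟨h3, h2⟩
  have hu0 : 0 ≤ (u : R) := hu ▸ h3.trans h1
  refine ⟨u, hu, hu0, (CStarAlgebra.one_le_inv_iff_le_one hu0).2 ?_⟩
  change (u : R) ≤ 1
  rw [hu]
  exact sub_le_self 1 ha

theorem one_sub_units_inv_le {u : Rˣ} (hu : 1 ≤ (u : R)) :
    ∃ c : ℝ, 0 < c ∧ c < 1 ∧ 1 - (↑u⁻¹ : R) ≤ (c : ℂ) • 1 := by
  have hu0 : 0 ≤ (u : R) := zero_le_one.trans hu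
  -- Adding 2 gives u ≤ r and r > 1 whatever the norm of u, so c = 1 - r⁻¹ is strictly between 0 and
  -- 1.
  set r : ℝ := ‖(u : R)‖ + 2
  have hr : 1 < r := by
    have := norm_nonneg (u : R)
    simp only [r]
    linarith
  have hrc : (r : ℂ) ≠ 0 := by exact_mod_cast (zero_lt_one.trans hr).ne'
  let w : Rˣ := ⟨(r : ℂ) • 1, (r : ℂ)⁻¹ • 1,
    by rw [smul_mul_smul_comm, mul_inv_cancel₀ hrc, one_smul, mul_one],
    by rw [smul_mul_smul_comm, inv_mul_cancel₀ hrc, one_smul, mul_one]⟩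
  have huw : (u : R) ≤ w := by
    refine (IsSelfAdjoint.of_nonneg hu0).le_algebraMap_norm_self.trans ?_
    change _ ≤ (r : ℂ) • (1 : R)
    rw [Complex.coe_smul, Algebra.algebraMap_eq_smul_one]
    exact smul_le_smul_of_nonneg_right (by simp [r]) zero_le_one
  have h := CStarAlgebra.inv_le_inv hu0 huw
  refine ⟨1 - r⁻¹, sub_pos.2 (inv_lt_one_of_one_lt₀ hr), sub_lt_self 1 (by positivity), ?_⟩
  rw [Complex.ofReal_sub, sub_smul, Complex.ofReal_one, one_smul, Complex.ofReal_inv]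
  exact sub_le_sub_left h 1

end Order

/-! ### Directedness of 𝓖_φ. -/

namespace KSGNS

variable {A B E : Type*} [NonUnitalCStarAlgebra A] [PartialOrder A] [StarOrderedRing A]
  [NonUnitalCStarAlgebra B] [PartialOrder B] [StarOrderedRing B] {φ : CStarWeight A B}
  [NormedAddCommGroup E] [NormedSpace ℂ E] [SMul Bᵐᵒᵖ E] [CStarModule Bᵐᵒᵖ E] [CompleteSpace E]
  (K : KSGNS φ E)

/-- `𝓖_φ` is directed if `φ` is everywhere defined. -/
theorem neBot_atTop_of_forall_mem (hN : ∀ a : A, a ∈ φ.N) : (atTop : Filter K.G).NeBot := by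
  obtain ⟨L, hL⟩ := K.exists_clm_Λ hN
  refine atTop_neBot_iff.2 ⟨?_, ⟨fun ρ₁ ρ₂ => ?_⟩⟩
  · obtain ⟨ρ, hρ, -⟩ := exists_mem_G hL (T := 0) HasVectors.zero le_rfl (c := 1 / 2)
      (by norm_num) (by norm_num) (by
        rw [Complex.coe_smul]
        exact smul_nonneg (by norm_num) zero_le_one)
    exact ⟨⟨ρ, hρ⟩⟩
  -- Here u = (1 - T_ρ)⁻¹, and u - 1 = u T_ρ inherits the vectors of T_ρ.
  have key (ρ : K.G) : ∃ u : (AdjointableEnd B E)ˣ,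
      (↑u⁻¹ : AdjointableEnd B E) = 1 - K.T ρ.1 (K.G_subset_H ρ.2) ∧
      0 ≤ (↑u⁻¹ : AdjointableEnd B E) ∧
      1 ≤ (u : AdjointableEnd B E) ∧ K.HasVectors L ((u : AdjointableEnd B E) - 1) := by
    obtain ⟨c, hc0, hc1, hc⟩ := K.T_le_smul_one ρ
    obtain ⟨u, hu, hu0, hu1⟩ := exists_units_eq_one_sub (K.T_nonneg _ _) hc1 hc
    have hv := hasVectors_T hL _ (K.G_subset_H ρ.2)
    have hcomm (x : A) : Commute (↑u⁻¹ : AdjointableEnd B E) (K.π x) := by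
      refine Commute.units_inv_left ?_
      rw [hu]
      exact (Commute.one_left _).sub_left (hv.1 x)
    refine ⟨u⁻¹, by rwa [inv_inv], by rwa [inv_inv], hu1, ?_⟩
    have h : (↑u⁻¹ : AdjointableEnd B E) - 1
        = (↑u⁻¹ : AdjointableEnd B E) * K.T ρ.1 (K.G_subset_H ρ.2) := by
      have h1 : K.T ρ.1 (K.G_subset_H ρ.2) = 1 - (u : AdjointableEnd B E) := by
        rw [hu, sub_sub_cancel]
      rw [h1, mul_sub, mul_one, Units.inv_mul]
    rw [h]
    exact hv.mul_left hcomm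
  obtain ⟨u₁, hu₁, hu₁0, hu₁1, hv₁⟩ := key ρ₁
  obtain ⟨u₂, hu₂, hu₂0, hu₂1, hv₂⟩ := key ρ₂
  have hle₁ : (u₁ : AdjointableEnd B E) ≤ u₁ + (u₂ - 1) :=
    le_add_of_nonneg_right (sub_nonneg.2 hu₂1)
  have hle₂ : (u₂ : AdjointableEnd B E) ≤ u₁ + (u₂ - 1) := by
    rw [← add_sub_assoc, add_comm, add_sub_assoc]
    exact le_add_of_nonneg_right (sub_nonneg.2 hu₁1)
  have h0₁ : 0 ≤ (u₁ : AdjointableEnd B E) := zero_le_one.trans hu₁1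
  have h0₂ : 0 ≤ (u₂ : AdjointableEnd B E) := zero_le_one.trans hu₂1
  -- With u = u₁ + u₂ - 1, the operator of the upper bound is 1 - u⁻¹ = u⁻¹((u₁ - 1) + (u₂ - 1)),
  -- which again has vectors.
  obtain ⟨u, hu⟩ := CStarAlgebra.isUnit_of_le _ hle₁ ⟨h0₁, u₁.isUnit⟩
  rw [← hu] at hle₁ hle₂
  have hu1 : 1 ≤ (u : AdjointableEnd B E) := hu₁1.trans hle₁
  obtain ⟨c, hc0, hc1, hc⟩ := one_sub_units_inv_le hu1
  have hv : K.HasVectors L (1 - (↑u⁻¹ : AdjointableEnd B E)) := by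
    have h : 1 - (↑u⁻¹ : AdjointableEnd B E)
        = (↑u⁻¹ : AdjointableEnd B E) * ((u₁ - 1) + (u₂ - 1)) := by
      have h1 : ((u₁ - 1) + (u₂ - 1) : AdjointableEnd B E) = u - 1 := by
        rw [hu]
        abel
      rw [h1, mul_sub, Units.inv_mul, mul_one]
    rw [h]
    refine (hv₁.add hv₂).mul_left fun x => Commute.units_inv_left ?_
    have h2 : (u : AdjointableEnd B E) = ((u₁ - 1) + (u₂ - 1)) + 1 := by
      rw [hu]
      abel
    rw [h2]
    exact ((hv₁.add hv₂).1 x).add_left (Commute.one_left _)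
  obtain ⟨ρ, hρ, hT⟩ := exists_mem_G hL hv (sub_nonneg.2 (CStarAlgebra.inv_le_one hu1)) hc0 hc1 hc
  -- Inversion reverses order, so w ≤ u gives T_σ ≤ 1 - u⁻¹; the positive difference implements ρ -
  -- σ, which is therefore completely positive.
  have hle (σ : K.G) (w : (AdjointableEnd B E)ˣ) (hw0 : 0 ≤ (w : AdjointableEnd B E))
      (hw : (↑w⁻¹ : AdjointableEnd B E) = 1 - K.T σ.1 (K.G_subset_H σ.2))
      (hwu : (w : AdjointableEnd B E) ≤ u) : σ ≤ ⟨ρ, hρ⟩ := by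
    have h1 := CStarAlgebra.inv_le_inv hw0 hwu
    rw [hw] at h1
    have h2 : 0 ≤ 1 - (↑u⁻¹ : AdjointableEnd B E) - K.T σ.1 (K.G_subset_H σ.2) :=
      sub_nonneg.2 (le_sub_comm.1 h1)
    refine Implements.isCP (K := K) (hN := hN) (fun a₁ a₂ b₁ b₂ => ?_) h2
    rw [AdjointableEnd.sub_apply, rinner_sub_left, hT, (K.T_spec _ (K.G_subset_H σ.2)).2]
    simp [mul_sub]
  exact ⟨⟨ρ, hρ⟩, hle ρ₁ u₁ h0₁ hu₁ hle₁, hle ρ₂ u₂ h0₂ hu₂ hle₂⟩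

/-- Were the filter trivial, any net would converge to 0, so lower semi-continuity would put every
a*a in the cone; but for everywhere defined φ the filter is proper. -/
theorem neBot_atTop (hlsc : K.IsLowerSemicontinuous) : (atTop : Filter K.G).NeBot := by
  by_contra h
  rw [not_neBot] at h
  refine (K.neBot_atTop_of_forall_mem fun a => ?_).ne h
  refine (hlsc.1 _ (star_mul_self_nonneg a)).2 ⟨0, ?_⟩
  rw [h]
  exact tendsto_bot

end KSGNS

end

theorem proposition3p1 {A B E : Type*}
    [NonUnitalCStarAlgebra A] [PartialOrder A] [StarOrderedRing A]
    [NonUnitalCStarAlgebra B] [PartialOrder B] [StarOrderedRing B]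
    [NormedAddCommGroup E] [NormedSpace ℂ E] [SMul Bᵐᵒᵖ E] [CStarModule Bᵐᵒᵖ E] [CompleteSpace E]
    (φ : CStarWeight A B) (hφ : φ.IsDenselyDefined)
    (K : KSGNS φ E) (hlsc : K.IsLowerSemicontinuous) :
    K.LambdaIsClosed ∧
    K.IsNondegenerate ∧
    ∀ v : E, Tendsto (fun ρ : K.G => (K.T ρ.1 (K.G_subset_H ρ.2)).1 v) atTop (𝓝 v) := by
  have := K.neBot_atTop hlsc
  exact ⟨K.lambdaIsClosed_of_neBot hlsc, K.isNondegenerate_of_neBot hlsc, K.tendsto_T hlsc⟩
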